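/- Let $N,m$ be natural numbers, $\mathbb T^N=\mathbb R^N/\mathbb Z^N$ (functions on $\mathbb T^N$ are identified with functions on $\mathbb R^N$ that are $1$-periodic in each coordinate), and for $1\le i,j\le m$ let $F_i:\mathbb T^N\times\mathbb R^N\to\mathbb R$, $f_i:\mathbb T^N\to\mathbb R$ and $d_{ij}:\mathbb T^N\to\mathbb R$ be continuous, with $D(x)=(d_{ij}(x))_{i,j}$, such that for all $x\in\mathbb T^N$: * $F_i(x,\cdot)$ is convex, $F_i(x,p)\to+\infty$ as $|p|\to\infty$, and $F_i(x,p)\ge F_i(x,0)=0$ for all $p\in\mathbb R^N$; * $f_i(x)\ge 0$; * $d_{ii}(x)\ge0$, $d_{ij}(x)\le 0$ for $i\ne j$, and $\sum_{j=1}^m d_{ij}(x)\ge 0$. Call a matrix $(a_{ij})$ irreducible if for every nonempty proper subset $I$ of $\{1,\dots,m\}$ there are $i\in I$, $j\notin I$ with $a_{ij}\neq0$. Suppose that one of the following holds: 1. $D(x)$ is irreducible for every $x\in\mathbb T^N$, and $\{x\in\mathbb T^N:\sum_{i=1}^m f_i(x)=0\}\ne\emptyset$; or 2. $D$ does not depend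 on $x$, is irreducible, and satisfies $\sum_{j=1}^m d_{ij}=0$ for all $i$. Then there is exactly one $c=(c_1,\dots,c_m)\in\mathbb R^m$ (the ergodic constant) such that $D(x)c=0$ for all $x\in\mathbb T^N$ and the system $$F_i(x,Dv_i)-f_i(x)+\sum_{j=1}^m d_{ij}(x)v_j=c_i\quad\text{in }\mathbb T^N,\qquad 1\le i\le m,$$ has a continuous viscosity solution $v:\mathbb T^N\to\mathbb R^m$; in case 1, $c=0$. Moreover, for every Lipschitz continuous $u_0:\mathbb T^N\to\mathbb R^m$ there are constants $C,L$ such that every continuous viscosity solution $u=(u_1,\dots,u_m):\mathbb T^N\times[0,\infty)\to\mathbb R^m$ of $$\frac{\partial u_i}{\partial t}+F_i(x,Du_i)-f_i(x)+\sum_{j=1}^m d_{ij}(x)u_j=0\ \text{ in }\mathbb T^N\times(0,\infty),\qquad u_i(\cdot,0)=u_{0,i},\qquad 1\le i\le m,$$ satisfies, for all $i$, all $x,y$ and all $t,s\ge0$, $$|u_i(x,t)+c_it|\le C,\qquad |u_i(x,t)-u_i(y,s)|\le L\,(|x-y|+|t-s|).$$ Consequently, for $i=1,\dots,m$, $u_i(x,t)/t\to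 -c_i$ as $t\to+\infty$, uniformly in $x\in\mathbb T^N$. -/

import Mathlib

noncomputable section

namespace HJSystem

/-- The space `ℝ^N` with its Euclidean norm. -/
abbrev Space (N : ℕ) := EuclideanSpace ℝ (Fin N)

/-- `g` is `1`-periodic in every coordinate, i.e. `g` is a function on the torus `𝕋^N = ℝ^N / ℤ^N`. -/
def Periodic {N : ℕ} {α : Type*} (g : Space N → α) : Prop :=
  ∀ (k : Fin N → ℤ) (x : Space N), g (x + WithLp.toLp 2 (fun n => (k n : ℝ))) = g x

/-- A real square matrix is irreducible if for every nonempty proper set `I` of indices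
there are `i ∈ I` and `j ∉ I` with `A i j ≠ 0`. -/
def Irreducible {m : ℕ} (A : Matrix (Fin m) (Fin m) ℝ) : Prop :=
  ∀ I : Set (Fin m), I.Nonempty → I ≠ Set.univ → ∃ i ∈ I, ∃ j ∉ I, A i j ≠ 0

/-- Standing assumptions on the Hamiltonians `H_i(x,p) = F_i(x,p) - f_i(x)` and on the coupling
matrix `D(x) = (d_ij(x))`. -/
structure Assumptions {N m : ℕ} (F : Fin m → Space N → Space N → ℝ) (f : Fin m → Space N → ℝ)
    (D : Space N → Matrix (Fin m) (Fin m) ℝ) : Prop where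
  /-- the coefficients of `D` are continuous functions on the torus -/
  D_continuous : ∀ i j, Continuous fun x => D x i j
  D_periodic : Periodic D
  D_diag : ∀ x i, 0 ≤ D x i i
  D_offdiag : ∀ x i j, i ≠ j → D x i j ≤ 0
  D_row : ∀ x i, 0 ≤ ∑ j, D x i j
  F_continuous : ∀ i, Continuous fun q : Space N × Space N => F i q.1 q.2
  F_periodic : ∀ i p, Periodic fun x => F i x p
  F_convex : ∀ i x, ConvexOn ℝ Set.univ (F i x)
  /-- coercivity: `F_i(x,p) → +∞` as `|p| → ∞` -/
  F_coercive : ∀ i x, Filter.Tendsto (F i x) (Filter.cocompact (Space N)) Filter.atTop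
  F_zero : ∀ i x, F i x 0 = 0
  F_nonneg : ∀ i x p, 0 ≤ F i x p
  f_continuous : ∀ i, Continuous (f i)
  f_periodic : ∀ i, Periodic (f i)
  f_nonneg : ∀ i x, 0 ≤ f i x

/-- The set of points where `∑ i, f_i(x) = 0`. -/
def zeroSet {N m : ℕ} (f : Fin m → Space N → ℝ) : Set (Space N) :=
  {x | ∑ i, f i x = 0}

/-- First set of additional hypotheses: `D(x)` is irreducible for all `x`, and the `f_i` have a
common zero. -/
def CommonZeroCase {N m : ℕ} (f : Fin m → Space N → ℝ)
    (D : Space N → Matrix (Fin m) (Fin m) ℝ) : Prop :=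
  (∀ x, Irreducible (D x)) ∧ (zeroSet f).Nonempty

/-- Second set of additional hypotheses: `D` does not depend on `x`, has vanishing row sums and is
irreducible. -/
def ConstantCouplingCase {N m : ℕ} (D : Space N → Matrix (Fin m) (Fin m) ℝ) : Prop :=
  (∀ x y, D x = D y) ∧ (∀ x i, ∑ j, D x i j = 0) ∧ ∀ x, Irreducible (D x)

section Stationary

variable {N m : ℕ} (F : Fin m → Space N → Space N → ℝ) (f : Fin m → Space N → ℝ)
  (D : Space N → Matrix (Fin m) (Fin m) ℝ) (c : Fin m → ℝ)

/-- Viscosity subsolution property for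
`F_i(x, Dv_i) - f_i(x) + ∑ j, d_ij(x) v_j = c_i`, `1 ≤ i ≤ m`. -/
def IsStationarySubsolution (v : Space N → Fin m → ℝ) : Prop :=
  ∀ (i : Fin m) (φ : Space N → ℝ), ContDiff ℝ 1 φ → ∀ x,
    IsLocalMax (fun y => v y i - φ y) x →
      F i x (gradient φ x) - f i x + ∑ j, D x i j * v x j ≤ c i

/-- Viscosity supersolution property for the same system. -/
def IsStationarySupersolution (v : Space N → Fin m → ℝ) : Prop :=
  ∀ (i : Fin m) (φ : Space N → ℝ), ContDiff ℝ 1 φ → ∀ x,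
    IsLocalMin (fun y => v y i - φ y) x →
      c i ≤ F i x (gradient φ x) - f i x + ∑ j, D x i j * v x j

/-- Continuous viscosity solutions, on the torus, of
`F_i(x, Dv_i) - f_i(x) + ∑ j, d_ij(x) v_j = c_i`, `1 ≤ i ≤ m`. -/
structure IsStationarySolution (v : Space N → Fin m → ℝ) : Prop where
  continuous : Continuous v
  periodic : Periodic v
  sub : IsStationarySubsolution F f D c v
  super : IsStationarySupersolution F f D c v

/-- `c` is an ergodic constant: `c ∈ ker D(x)` for all `x`, and the stationary system with
right-hand side `c` has a continuous viscosity solution on the torus. -/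
def IsErgodicConstant : Prop :=
  (∀ x i, ∑ j, D x i j * c j = 0) ∧ ∃ v : Space N → Fin m → ℝ, IsStationarySolution F f D c v

end Stationary

section Evolution

variable {N m : ℕ} (F : Fin m → Space N → Space N → ℝ) (f : Fin m → Space N → ℝ)
  (D : Space N → Matrix (Fin m) (Fin m) ℝ)

/-- Viscosity subsolution property, in `𝕋^N × (0,∞)`, for
`∂u_i/∂t + F_i(x, Du_i) - f_i(x) + ∑ j, d_ij(x) u_j = 0`, `1 ≤ i ≤ m`.
As the extremum is local and `t > 0`, the values of `u` at negative times play no role. -/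
def IsEvolutionSubsolution (u : Space N → ℝ → Fin m → ℝ) : Prop :=
  ∀ (i : Fin m) (φ : Space N × ℝ → ℝ), ContDiff ℝ 1 φ → ∀ (x : Space N) (t : ℝ), 0 < t →
    IsLocalMax (fun q : Space N × ℝ => u q.1 q.2 i - φ q) (x, t) →
      deriv (fun s => φ (x, s)) t + (F i x (gradient (fun y => φ (y, t)) x) - f i x)
        + ∑ j, D x i j * u x t j ≤ 0

/-- Viscosity supersolution property for the same system. -/
def IsEvolutionSupersolution (u : Space N → ℝ → Fin m → ℝ) : Prop :=
  ∀ (i : Fin m) (φ : Space N × ℝ → ℝ), ContDiff ℝ 1 φ → ∀ (x : Space N) (t : ℝ), 0 < t →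
    IsLocalMin (fun q : Space N × ℝ => u q.1 q.2 i - φ q) (x, t) →
      0 ≤ deriv (fun s => φ (x, s)) t + (F i x (gradient (fun y => φ (y, t)) x) - f i x)
        + ∑ j, D x i j * u x t j

/-- Continuous viscosity solutions on `𝕋^N × [0,∞)` of the evolutive system with initial
datum `u₀`. -/
structure IsEvolutionSolution (u₀ : Space N → Fin m → ℝ) (u : Space N → ℝ → Fin m → ℝ) :
    Prop where
  continuousOn : ContinuousOn (fun q : Space N × ℝ => u q.1 q.2) (Set.univ ×ˢ Set.Ici 0)
  periodic : ∀ t, 0 ≤ t → Periodic fun x => u x t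
  sub : IsEvolutionSubsolution F f D u
  super : IsEvolutionSupersolution F f D u
  initial : ∀ x, u x 0 = u₀ x

end Evolution

end HJSystem

end

/-! Existence of `c` comes from vanishing discount. For `lam > 0` the matrix `D + lam • 1` has row
sums at least `lam`. Then `0` is a subsolution, because `F i x 0 = 0 ≤ f i x`, and a large constant
is a supersolution, so Perron's method gives a nonnegative solution `v`
(`Assumptions.exists_solution_of_pos_row`). Since `F ≥ 0`, the coupling term of `v` is at most `f`
at every point. Irreducibility turns this one-sided bound into a bound on `v x i - v x j` that does
not depend on `lam` (`Assumptions.exists_oscillation_le`), and coercivity then gives a uniform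
Lipschitz constant.

To pass to the limit, a constant `κ` is subtracted from `v` (`Assumptions.exists_normalization`). At
a common zero of the `f i` the maximum principle forces `v = 0`, so `κ = 0` works. For constant
coupling, zero row sums make any constant invisible to `D`, and `lam * κ` stays bounded; its limit
`μ` yields `c = (-μ, ..., -μ)`.

The rest depends on comparison for the evolution system, where the `x`-dependence of `F` satisfies
no structural condition. Time variables are doubled with a fixed penalization and space variables
with a parameter tending to infinity. The subsolution inequality bounds `F`, hence the gradients, at
the doubled maxima; they converge along an ultrafilter and the two Hamiltonian terms cancel in the
limit (`Assumptions.exists_doubled_max`).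

As `D c = 0`, a stationary solution `v` gives the evolution solution `v - c t`. Comparing two of
these gives uniqueness of `c`; comparing one with `u` bounds `u + c t`. Barriers at time `0` and
time translation give the Lipschitz bound in time, which fed into the equation gives the one in
space by coercivity. The coupling term stays bounded for all times because `D u = D (u + c t)`.
Convexity serves only to make coercivity uniform in `x`. -/

namespace HJSystem

open Filter Topology Set

/-! ### Periodic functions -/

/-- The integer vector `k`, as a point of `ℝ^N`. -/
abbrev intVec {N : ℕ} (k : Fin N → ℤ) : Space N := WithLp.toLp 2 (fun n => (k n : ℝ))

lemma exists_isCompact_translate (N : ℕ) :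
    ∃ Q : Set (Space N), IsCompact Q ∧ ∀ x, ∃ k : Fin N → ℤ, x + intVec k ∈ Q := by
  refine ⟨(WithLp.toLp 2) '' (Set.pi univ fun _ : Fin N => Icc (0 : ℝ) 1),
    (isCompact_univ_pi fun _ => isCompact_Icc).image (PiLp.continuous_toLp 2 _), fun x => ?_⟩
  refine ⟨fun n => -⌊x n⌋, fun n => x n - ⌊x n⌋, fun n _ => ⟨?_, ?_⟩, ?_⟩
  · simp
  · have := (Int.lt_floor_add_one (x n)).le
    show x n - ⌊x n⌋ ≤ 1
    linarith
  · ext n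
    simp [sub_eq_add_neg]

lemma Periodic.exists_isMax {N : ℕ} {g : Space N → ℝ} (hp : Periodic g) (hg : Continuous g) :
    ∃ x, ∀ y, g y ≤ g x := by
  obtain ⟨Q, hQ, hk⟩ := exists_isCompact_translate N
  obtain ⟨k₀, h₀⟩ := hk 0
  obtain ⟨x, -, hx⟩ := hQ.exists_isMaxOn ⟨_, h₀⟩ hg.continuousOn
  refine ⟨x, fun y => ?_⟩
  obtain ⟨k, h⟩ := hk y
  rw [← hp k y]
  exact hx h

lemma Periodic.exists_abs_le {N : ℕ} {g : Space N → ℝ} (hp : Periodic g) (hg : Continuous g) :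
    ∃ B, ∀ x, |g x| ≤ B := by
  have hp' : Periodic fun x => |g x| := fun k x => by simp only [hp k x]
  obtain ⟨x, hx⟩ := hp'.exists_isMax hg.abs
  exact ⟨_, hx⟩

lemma Periodic.comp {N : ℕ} {α β : Type*} {g : Space N → α} (hp : Periodic g) (h : α → β) :
    Periodic fun x => h (g x) := fun k x => congrArg h (hp k x)

/-- A finite family of bounded functions has a common bound. -/
lemma exists_common_bound {ι α : Type*} [Finite ι] {g : ι → α → ℝ}
    (h : ∀ i, ∃ B, ∀ x, |g i x| ≤ B) : ∃ B, 0 ≤ B ∧ ∀ i x, |g i x| ≤ B := by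
  have := Fintype.ofFinite ι
  choose B hB using h
  refine ⟨∑ i, |B i|, Finset.sum_nonneg fun i _ => abs_nonneg _, fun i x => ?_⟩
  exact (hB i x).trans ((le_abs_self _).trans
    (Finset.single_le_sum (f := fun i => |B i|) (fun i _ => abs_nonneg _) (Finset.mem_univ i)))

/-! ### Limits along ultrafilters -/

/-- Ultrafilters replace the extraction of subsequences: one fixed ultrafilter makes every bounded
sequence converge, even uncountably many at once. -/
lemma exists_tendsto_of_eventually_mem {ι X : Type*} [TopologicalSpace X] {s : Set X}
    (hs : IsCompact s) (l : Ultrafilter ι) {y : ι → X} (hy : ∀ᶠ n in (l : Filter ι), y n ∈ s) :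
    ∃ x ∈ s, Tendsto y l (𝓝 x) := by
  obtain ⟨x, hx, h⟩ := hs.ultrafilter_le_nhds (l.map y) (by
    simpa [Filter.le_principal_iff] using show y ⁻¹' s ∈ l from hy)
  exact ⟨x, hx, h⟩

lemma exists_eventually_eq_of_finite {ι X : Type*} [Finite X] (l : Ultrafilter ι) (y : ι → X) :
    ∃ x, ∀ᶠ n in (l : Filter ι), y n = x := by
  let _ : TopologicalSpace X := ⊥
  have : DiscreteTopology X := ⟨rfl⟩
  obtain ⟨x, -, h⟩ := exists_tendsto_of_eventually_mem (Set.finite_univ (α := X)).isCompact l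
    (y := y) (by simp)
  exact ⟨x, by simpa [nhds_discrete] using h⟩

/-! ### Gradients of test functions -/

section Gradient

variable {N : ℕ} {φ ψ : Space N → ℝ} {x : Space N}

lemma continuous_gradient (hφ : ContDiff ℝ 1 φ) : Continuous (gradient φ) := by
  have : Continuous (fderiv ℝ φ) := hφ.continuous_fderiv (by norm_num)
  exact (InnerProductSpace.toDual ℝ (Space N)).symm.continuous.comp this

lemma gradient_add_mul_norm_sub_sq (hφ : DifferentiableAt ℝ φ x) (b : ℝ) (a : Space N) :
    gradient (fun y => φ y + b * ‖y - a‖ ^ 2) x = gradient φ x + (2 * b) • (x - a) := by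
  apply HasGradientAt.gradient
  rw [hasGradientAt_iff_hasFDerivAt]
  have h2 : HasFDerivAt (fun y : Space N => y - a) (ContinuousLinearMap.id ℝ _) x :=
    (hasFDerivAt_id x).sub_const a
  refine (hφ.hasGradientAt.hasFDerivAt.add (h2.norm_sq.const_mul b)).congr_fderiv ?_
  ext y
  simp
  ring

lemma contDiff_mul_norm_sub_sq (b : ℝ) (a : Space N) :
    ContDiff ℝ 1 fun y : Space N => b * ‖y - a‖ ^ 2 :=
  contDiff_const.mul (ContDiff.norm_sq ℝ (by fun_prop))

lemma gradient_neg : gradient (fun y => -φ y) x = -gradient φ x := by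
  simp only [gradient, fderiv_fun_neg, map_neg]

lemma gradient_eq_of_isLocalMax_sub (hφ : DifferentiableAt ℝ φ x) (hψ : DifferentiableAt ℝ ψ x)
    (h : IsLocalMax (fun y => φ y - ψ y) x) : gradient φ x = gradient ψ x := by
  have h1 := h.fderiv_eq_zero
  rw [fderiv_fun_sub hφ hψ, sub_eq_zero] at h1
  simp only [gradient, h1]

/-- Along `x - h • p` with `p = gradient φ x`, the test function falls at rate `‖p‖ ^ 2`, while `w`
falls at rate at most `K * ‖p‖`. Touching from above forces the second rate to be no smaller than
the first. -/
lemma norm_gradient_le_of_isLocalMax_sub {w : Space N → ℝ} {K : NNReal} (hw : LipschitzWith K w)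
    (hφ : DifferentiableAt ℝ φ x) (h : IsLocalMax (fun y => w y - φ y) x) :
    ‖gradient φ x‖ ≤ K := by
  set p := gradient φ x with hp
  by_contra! hlt
  have hp0 : 0 < ‖p‖ := lt_of_le_of_lt K.2 hlt
  have hline : HasDerivAt (fun h : ℝ => x - h • p) (-p) 0 := by
    simpa using ((hasDerivAt_id (0 : ℝ)).smul_const p).const_sub x
  have h0 : HasDerivAt (fun h : ℝ => φ (x - h • p)) (-(‖p‖ ^ 2)) 0 := by
    have h1 : HasFDerivAt φ (InnerProductSpace.toDual ℝ (Space N) p) (x - (0 : ℝ) • p) := by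
      simpa [hp] using hφ.hasGradientAt.hasFDerivAt
    have := h1.comp_hasDerivAt (0 : ℝ) hline
    refine this.congr_deriv ?_
    simp
  have h1 : Tendsto (fun h : ℝ => h⁻¹ • (φ (x - (0 + h) • p) - φ (x - (0 : ℝ) • p))) (𝓝[>] 0)
      (𝓝 (-(‖p‖ ^ 2))) := h0.tendsto_slope_zero_right
  have hcont : Tendsto (fun h : ℝ => x - h • p) (𝓝[>] 0) (𝓝 x) := by
    have := hline.continuousAt.tendsto
    simp only [zero_smul, sub_zero] at this
    exact this.mono_left nhdsWithin_le_nhds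
  have h2 : -(K * ‖p‖) ≤ -(‖p‖ ^ 2) := by
    refine ge_of_tendsto h1 ?_
    filter_upwards [hcont.eventually h, self_mem_nhdsWithin] with t ht ht0
    have ht0 : 0 < t := ht0
    have h3 := hw.dist_le_mul x (x - t • p)
    rw [Real.dist_eq, dist_eq_norm, sub_sub_cancel, norm_smul, Real.norm_of_nonneg ht0.le] at h3
    have h4 := (le_abs_self _).trans h3
    simp only [zero_add, zero_smul, sub_zero, smul_eq_mul]
    rw [le_inv_mul_iff₀ ht0]
    nlinarith
  nlinarith

end Gradient

/-! ### Stability of touching points -/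

lemma tendsto_apply_of_equilipschitz {N : ℕ} {ι : Type*} {l : Filter ι} {w : ι → Space N → ℝ}
    {R : NNReal} (hw : ∀ n, LipschitzWith R (w n)) {x : Space N} {a : ℝ}
    (hx : Tendsto (fun n => w n x) l (𝓝 a)) {y : ι → Space N} (hy : Tendsto y l (𝓝 x)) :
    Tendsto (fun n => w n (y n)) l (𝓝 a) := by
  have h : Tendsto (fun n => w n (y n) - w n x) l (𝓝 0) := by
    refine squeeze_zero_norm (a := fun n => R * ‖y n - x‖) (fun n => ?_) ?_
    · simpa [dist_eq_norm] using (hw n).dist_le_mul (y n) x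
    · simpa using ((tendsto_iff_norm_sub_tendsto_zero.1 hy).const_mul (R : ℝ))
  simpa using h.add hx

/-- If `v - φ` has a local maximum at `x` and the equi-Lipschitz functions `w n` converge to `v`
at `x` and stay asymptotically below `v`, then `φ`, up to a perturbation which is negligible
near `x`, touches `w n` from above at points converging to `x`. -/
lemma exists_tendsto_isLocalMax {N : ℕ} {ι : Type*} (l : Ultrafilter ι) {w : ι → Space N → ℝ}
    {v φ : Space N → ℝ} {R : NNReal} (hw : ∀ n, LipschitzWith R (w n)) (hφ : ContDiff ℝ 1 φ)
    {x : Space N} (hmax : IsLocalMax (fun y => v y - φ y) x)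
    (hx : Tendsto (fun n => w n x) l (𝓝 (v x)))
    (hle : ∀ z, ∀ ε > 0, ∀ᶠ n in (l : Filter ι), w n z ≤ v z + ε) :
    ∃ (ψ : Space N → ℝ) (y : ι → Space N), ContDiff ℝ 1 ψ ∧ Tendsto y l (𝓝 x) ∧
      (∀ᶠ n in (l : Filter ι), IsLocalMax (fun z => w n z - ψ z) (y n)) ∧
      Tendsto (fun n => gradient ψ (y n)) l (𝓝 (gradient φ x)) ∧
      Tendsto (fun n => w n (y n)) l (𝓝 (v x)) := by
  -- The quadratic term makes the maximum of `v - ψ` at `x` strict, so that maximizers of `w n - ψ`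
  -- on a small ball must converge to `x`.
  set ψ : Space N → ℝ := fun z => φ z + 1 * ‖z - x‖ ^ 2 with hψdef
  have hψ : ContDiff ℝ 1 ψ := hφ.add (contDiff_mul_norm_sub_sq 1 x)
  obtain ⟨r, hr, hball⟩ := Metric.nhds_basis_closedBall.mem_iff.1 hmax
  have hcomp : IsCompact (Metric.closedBall x r) := isCompact_closedBall x r
  have hne : (Metric.closedBall x r).Nonempty := ⟨x, by simp [hr.le]⟩
  have hex : ∀ n, ∃ y ∈ Metric.closedBall x r,
      IsMaxOn (fun z => w n z - ψ z) (Metric.closedBall x r) y := fun n =>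
    hcomp.exists_isMaxOn hne ((hw n).continuous.sub hψ.continuous).continuousOn
  choose y hy hymax using hex
  obtain ⟨z, hz, hyz⟩ := exists_tendsto_of_eventually_mem hcomp l (Eventually.of_forall hy)
  have hclose : Tendsto (fun n => w n (y n) - w n z) l (𝓝 0) :=
    tendsto_apply_of_equilipschitz (w := fun n y => w n y - w n z)
      (fun n => LipschitzWith.of_dist_le_mul fun a b => by simpa using (hw n).dist_le_mul a b)
      (by simp) hyz
  have hzx : z = x := by
    have key : ∀ ε > 0, ‖z - x‖ ^ 2 ≤ ε := by
      intro ε hε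
      have h1 : Tendsto (fun n => (w n (y n) - w n z) - (ψ (y n) - ψ z) - w n x) l
          (𝓝 (0 - (ψ z - ψ z) - v x)) :=
        (hclose.sub (((hψ.continuous.tendsto z).comp hyz).sub_const _)).sub hx
      have h2 : -(v z + ε) + ψ z - ψ x ≤ 0 - (ψ z - ψ z) - v x := by
        refine ge_of_tendsto h1 ?_
        filter_upwards [hle z ε hε] with n hn
        have := hymax n (show x ∈ Metric.closedBall x r by simp [hr.le])
        simp only [mem_ofPred_eq] at this
        linarith
      have h3 := hball hz
      simp only [mem_ofPred_eq] at h3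
      simp only [hψdef, sub_self, norm_zero] at h2
      linarith
    have : ‖z - x‖ ^ 2 ≤ 0 := le_of_forall_pos_le_add fun ε hε => by simpa using key ε hε
    have h0 : ‖z - x‖ = 0 := by nlinarith [norm_nonneg (z - x)]
    exact sub_eq_zero.1 (norm_eq_zero.1 h0)
  subst hzx
  refine ⟨ψ, y, hψ, hyz, ?_, ?_, ?_⟩
  · filter_upwards [hyz.eventually (Metric.ball_mem_nhds z hr)] with n hn
    exact (hymax n).isLocalMax (mem_of_superset (Metric.isOpen_ball.mem_nhds hn)
      Metric.ball_subset_closedBall)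
  · have h1 := ((continuous_gradient hψ).tendsto z).comp hyz
    rwa [show gradient ψ z = gradient φ z by
      rw [hψdef, gradient_add_mul_norm_sub_sq (hφ.differentiable (by norm_num) z)]; simp] at h1
  · exact tendsto_apply_of_equilipschitz hw hx hyz

/-- A bounded continuous function is touched from above by paraboloids at a dense set of points. -/
lemma exists_isLocalMax_near {N : ℕ} {w : Space N → ℝ} {B : ℝ} (hw : Continuous w)
    (hB : ∀ x, |w x| ≤ B) (x : Space N) {s : Set (Space N)} (hs : s ∈ 𝓝 x) :
    ∃ (ψ : Space N → ℝ) (y : Space N), y ∈ s ∧ ContDiff ℝ 1 ψ ∧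
      IsLocalMax (fun z => w z - ψ z) y := by
  obtain ⟨r, hr, hball⟩ := Metric.nhds_basis_closedBall.mem_iff.1 hs
  have hB0 : 0 ≤ B := (abs_nonneg _).trans (hB x)
  -- On the sphere of radius `r` the penalty `b * r ^ 2 = 2 * B + 1` exceeds the oscillation of `w`,
  -- so the maximum over the ball is interior.
  set b : ℝ := (2 * B + 1) / r ^ 2
  have hb : b * r ^ 2 = 2 * B + 1 := div_mul_cancel₀ _ (by positivity)
  have hb0 : 0 < b := by positivity
  have hcont : Continuous fun y => w y - b * ‖y - x‖ ^ 2 := by fun_prop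
  obtain ⟨y, hy, hmax⟩ := (isCompact_closedBall x r).exists_isMaxOn ⟨x, by simp [hr.le]⟩
    hcont.continuousOn
  refine ⟨fun y => b * ‖y - x‖ ^ 2, y, hball hy, contDiff_mul_norm_sub_sq b x, ?_⟩
  refine hmax.isLocalMax (mem_of_superset (Metric.isOpen_ball.mem_nhds ?_)
    Metric.ball_subset_closedBall)
  have h1 := hmax (show x ∈ Metric.closedBall x r by simp [hr.le])
  simp only [mem_ofPred_eq, sub_self, norm_zero] at h1
  have h2 : b * ‖y - x‖ ^ 2 < b * r ^ 2 := by
    linarith [(abs_le.1 (hB x)).1, (abs_le.1 (hB y)).2]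
  rw [mem_ball_iff_norm]
  exact lt_of_pow_lt_pow_left₀ 2 hr.le (lt_of_mul_lt_mul_left h2 hb0.le)

/-- A bounded function whose touching gradients are bounded is Lipschitz continuous. -/
lemma lipschitzWith_of_norm_gradient_le {N : ℕ} {w : Space N → ℝ} {R : NNReal} {B : ℝ}
    (hw : Continuous w) (hB : ∀ x, |w x| ≤ B)
    (h : ∀ φ : Space N → ℝ, ContDiff ℝ 1 φ → ∀ x, IsLocalMax (fun y => w y - φ y) x →
      ‖gradient φ x‖ ≤ R) : LipschitzWith R w := by
  have key : ∀ x y, w y - w x ≤ R * ‖y - x‖ := by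
    intro x y
    refine le_of_forall_pos_le_add fun ε hε => ?_
    set η : ℝ := ε / (‖y - x‖ + 1)
    have hη : 0 < η := by positivity
    have hηy : η * ‖y - x‖ ≤ ε := by
      rw [div_mul_eq_mul_div, div_le_iff₀ (by positivity)]
      nlinarith [norm_nonneg (y - x)]
    set R' : ℝ := R + η
    have hR' : 0 < R' := by positivity
    obtain ⟨z, hz⟩ : ∃ z, ∀ y, w y - R' * ‖y - x‖ ≤ w z - R' * ‖z - x‖ := by
      refine Continuous.exists_forall_ge' (f := fun y => w y - R' * ‖y - x‖) (by fun_prop) x ?_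
      have h1 : Tendsto (fun y : Space N => R' * ‖y - x‖) (cocompact _) atTop := by
        refine Tendsto.const_mul_atTop hR' ?_
        refine tendsto_atTop_mono (f := fun y : Space N => ‖y‖ - ‖x‖)
          (fun y => norm_sub_norm_le y x) ?_
        exact tendsto_atTop_add_const_right _ _ (tendsto_norm_cocompact_atTop (E := Space N))
      filter_upwards [h1.eventually_ge_atTop (2 * B)] with y hy
      simp only [sub_self, norm_zero, mul_zero, sub_zero]
      linarith [(abs_le.1 (hB y)).2, (abs_le.1 (hB x)).1]
    by_cases hzx : z = x
    · have := hz y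
      subst hzx
      simp only [sub_self, norm_zero, mul_zero, sub_zero] at this
      have : w y - w z ≤ (R + η) * ‖y - z‖ := by linarith
      linarith
    · exfalso
      set a := ‖z - x‖
      have ha : 0 < a := norm_pos_iff.2 (sub_ne_zero.2 hzx)
      -- The cone `R' * ‖y - x‖` might be used directly away from its vertex. This paraboloid is
      -- smooth everywhere, lies above the cone and meets it on the sphere `‖y - x‖ = a`, where its
      -- gradient has norm `R' > R`.
      have h1 := h (fun y => (R' * a / 2) + R' / (2 * a) * ‖y - x‖ ^ 2)
        (contDiff_const.add (contDiff_mul_norm_sub_sq _ x)) z ?_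
      · rw [gradient_add_mul_norm_sub_sq (by fun_prop), gradient_fun_const, zero_add, norm_smul,
          Real.norm_of_nonneg (by positivity)] at h1
        have h2 : 2 * (R' / (2 * a)) * ‖z - x‖ = R' := by
          change 2 * (R' / (2 * a)) * a = R'
          field_simp
        rw [h2] at h1
        simp only [R'] at h1
        linarith
      · refine Eventually.of_forall fun y => ?_
        have h2 : R' * ‖y - x‖ ≤ R' * a / 2 + R' / (2 * a) * ‖y - x‖ ^ 2 := by
          have : R' * a / 2 + R' / (2 * a) * ‖y - x‖ ^ 2 - R' * ‖y - x‖
              = R' / (2 * a) * (‖y - x‖ - a) ^ 2 := by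
            field_simp
            ring
          have h3 : 0 ≤ R' / (2 * a) * (‖y - x‖ - a) ^ 2 := by positivity
          linarith
        have h3 : R' * ‖z - x‖ = R' * a / 2 + R' / (2 * a) * ‖z - x‖ ^ 2 := by
          change R' * a = R' * a / 2 + R' / (2 * a) * a ^ 2
          field_simp
          ring
        have h4 := hz y
        simp only
        linarith
  refine LipschitzWith.of_dist_le_mul fun x y => ?_
  rw [Real.dist_eq, dist_eq_norm, abs_le]
  have h1 := key x y
  rw [norm_sub_rev] at h1
  constructor <;> linarith [key y x]

/-! ### Consequences of the standing assumptions -/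

section Assumptions

variable {N m : ℕ} {F : Fin m → Space N → Space N → ℝ} {f : Fin m → Space N → ℝ}
  {D : Space N → Matrix (Fin m) (Fin m) ℝ}

/-- Coercivity of the Hamiltonians is uniform in `x`. -/
lemma Assumptions.exists_norm_le (hyp : Assumptions F f D) (M : ℝ) :
    ∃ R : NNReal, ∀ i x p, F i x p ≤ M → ‖p‖ ≤ R := by
  obtain ⟨Q, hQ, hk⟩ := exists_isCompact_translate N
  have hone : ∀ i, ∃ R : NNReal, ∀ x ∈ Q, ∀ p, F i x p ≤ M → ‖p‖ ≤ R := by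
    intro i
    refine hQ.induction_on (p := fun s => ∃ R : NNReal, ∀ x ∈ s, ∀ p, F i x p ≤ M → ‖p‖ ≤ R)
      ⟨0, by simp⟩ (fun s t hst ⟨R, hR⟩ => ⟨R, fun x hx => hR x (hst hx)⟩) ?_ ?_
    · rintro s t ⟨R, hR⟩ ⟨R', hR'⟩
      refine ⟨max R R', fun x hx p hp => ?_⟩
      rw [NNReal.coe_max]
      rcases hx with hx | hx
      · exact (hR x hx p hp).trans (le_max_left _ _)
      · exact (hR' x hx p hp).trans (le_max_right _ _)
    · intro x₀ _
      -- The threshold is `max M 0` rather than `M` because the convexity argument below multiplies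
      -- it by a factor `a ≤ 1`.
      have h1 := (hyp.F_coercive i x₀).eventually_gt_atTop (max M 0)
      obtain ⟨R, hR⟩ := (hasBasis_cocompact.eventually_iff.1 h1)
      obtain ⟨R₁, hR₁⟩ := hR.1.isBounded.subset_ball (0 : Space N)
      set r : ℝ := max R₁ 1
      have hr : 0 < r := lt_of_lt_of_le one_pos (le_max_right _ _)
      have h2 : ∀ p ∈ Metric.sphere (0 : Space N) r, max M 0 < F i x₀ p := by
        intro p hp
        refine hR.2 fun hpR => ?_
        have h3 := hR₁ hpR
        rw [mem_ball_zero_iff] at h3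
        rw [mem_sphere_zero_iff_norm] at hp
        linarith [le_max_left R₁ 1]
      have h3 : ∀ᶠ x in 𝓝 x₀, ∀ p ∈ Metric.sphere (0 : Space N) r, max M 0 < F i x p := by
        refine (isCompact_sphere (0 : Space N) r).eventually_forall_of_forall_eventually
          fun p hp => ?_
        exact (hyp.F_continuous i).continuousAt.eventually (lt_mem_nhds (h2 p hp))
      refine ⟨_, mem_nhdsWithin_of_mem_nhds h3, ⟨r, hr.le⟩, fun x hx p hp => ?_⟩
      simp only [mem_ofPred_eq] at hx
      change ‖p‖ ≤ r
      by_contra! hlt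
      have hp0 : 0 < ‖p‖ := hr.trans hlt
      -- Scaling `p` back to the sphere: convexity and `F i x 0 = 0` give `F i x (a • p) ≤ a * F i x
      -- p`, so a lower bound on the sphere propagates outward.
      set a := r / ‖p‖
      have ha0 : 0 < a := by positivity
      have ha1 : a ≤ 1 := (div_le_one hp0).2 hlt.le
      have h4 := hx (a • p) (by
        rw [mem_sphere_zero_iff_norm, norm_smul, Real.norm_of_nonneg ha0.le]
        exact div_mul_cancel₀ _ hp0.ne')
      have h5 := (hyp.F_convex i x).2 (mem_univ p) (mem_univ 0) ha0.le (sub_nonneg.2 ha1)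
        (by ring)
      rw [smul_zero, add_zero, hyp.F_zero, smul_zero, add_zero, smul_eq_mul] at h5
      have h6 : F i x p ≤ max M 0 := hp.trans (le_max_left _ _)
      nlinarith [le_max_right M 0]
  choose R hR using hone
  refine ⟨∑ i, R i, fun i x p hp => ?_⟩
  obtain ⟨k, hkQ⟩ := hk x
  refine (hR i _ hkQ p ?_).trans
    (NNReal.coe_le_coe.2 (Finset.single_le_sum (fun _ _ => zero_le) (Finset.mem_univ i)))
  have : F i (x + intVec k) p = F i x p := hyp.F_periodic i p k x
  rwa [this]

lemma Assumptions.exists_f_le (hyp : Assumptions F f D) : ∃ A, 0 ≤ A ∧ ∀ i x, f i x ≤ A := by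
  obtain ⟨A, hA, h⟩ := exists_common_bound fun i => (hyp.f_periodic i).exists_abs_le
    (hyp.f_continuous i)
  exact ⟨A, hA, fun i x => (le_abs_self _).trans (h i x)⟩

lemma Assumptions.periodic_entry (hyp : Assumptions F f D) (i j : Fin m) :
    Periodic fun x => D x i j := hyp.D_periodic.comp fun A => A i j

lemma Assumptions.exists_D_le (hyp : Assumptions F f D) :
    ∃ A, 0 ≤ A ∧ ∀ x i j, |D x i j| ≤ A := by
  obtain ⟨A, hA, h⟩ := exists_common_bound (g := fun (q : Fin m × Fin m) x => D x q.1 q.2)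
    fun q => (hyp.periodic_entry q.1 q.2).exists_abs_le (hyp.D_continuous q.1 q.2)
  exact ⟨A, hA, fun x i j => h (i, j) x⟩

/-- The coupling term is bounded by a multiple of the size of the vector. -/
lemma Assumptions.exists_abs_coupling_le (hyp : Assumptions F f D) :
    ∃ A, 0 ≤ A ∧ ∀ x i (a : Fin m → ℝ) B, (∀ j, |a j| ≤ B) → |∑ j, D x i j * a j| ≤ A * B := by
  obtain ⟨A, hA, h⟩ := hyp.exists_D_le
  refine ⟨m * A, by positivity, fun x i a B hB => ?_⟩
  calc |∑ j, D x i j * a j| ≤ ∑ j, |D x i j * a j| := Finset.abs_sum_le_sum_abs _ _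
    _ ≤ ∑ _j : Fin m, A * B := by
        refine Finset.sum_le_sum fun j _ => ?_
        rw [abs_mul]
        exact mul_le_mul (h x i j) (hB j) (abs_nonneg _) hA
    _ = m * A * B := by simp [mul_assoc]

/-- Maximum principle for the coupling. -/
lemma Assumptions.coupling_nonneg (hyp : Assumptions F f D) (x : Space N) {i : Fin m}
    {a : Fin m → ℝ} (ha : ∀ j, a j ≤ a i) (hi : 0 ≤ a i) : 0 ≤ ∑ j, D x i j * a j := by
  have h1 : ∑ j, D x i j * a i ≤ ∑ j, D x i j * a j := by
    refine Finset.sum_le_sum fun j _ => ?_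
    by_cases hij : i = j
    · rw [hij]
    · exact mul_le_mul_of_nonpos_left (ha j) (hyp.D_offdiag x i j hij)
  rw [← Finset.sum_mul] at h1
  exact (mul_nonneg (hyp.D_row x i) hi).trans h1

/-- The coupling term of component `i` is nonincreasing in the other components. -/
lemma Assumptions.coupling_mono (hyp : Assumptions F f D) (x : Space N) {i : Fin m}
    {a b : Fin m → ℝ} (hab : ∀ j, a j ≤ b j) :
    ∑ j, D x i j * b j - D x i i * b i ≤ ∑ j, D x i j * a j - D x i i * a i := by
  rw [← Finset.add_sum_erase _ _ (Finset.mem_univ i),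
    ← Finset.add_sum_erase (f := fun j => D x i j * a j) _ (Finset.mem_univ i),
    add_sub_cancel_left, add_sub_cancel_left]
  refine Finset.sum_le_sum fun j hj => ?_
  exact mul_le_mul_of_nonpos_left (hab j) (hyp.D_offdiag x i j (Finset.ne_of_mem_erase hj).symm)

lemma Assumptions.continuous_coupling (hyp : Assumptions F f D) {X : Type*} [TopologicalSpace X]
    {x : X → Space N} {v : X → Fin m → ℝ} (hx : Continuous x) (hv : ∀ j, Continuous fun q => v q j)
    (i : Fin m) : Continuous fun q => ∑ j, D (x q) i j * v q j :=
  continuous_finsetSum _ fun j _ => ((hyp.D_continuous i j).comp hx).mul (hv j)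

lemma Assumptions.tendsto_coupling (hyp : Assumptions F f D) {ι : Type*} {l : Filter ι}
    {x : ι → Space N} {v : ι → Fin m → ℝ} {x₀ : Space N} {v₀ : Fin m → ℝ}
    (hx : Tendsto x l (𝓝 x₀)) (hv : ∀ j, Tendsto (fun n => v n j) l (𝓝 (v₀ j))) (i : Fin m) :
    Tendsto (fun n => ∑ j, D (x n) i j * v n j) l (𝓝 (∑ j, D x₀ i j * v₀ j)) :=
  tendsto_finsetSum _ fun j _ => (((hyp.D_continuous i j).tendsto x₀).comp hx).mul (hv j)

lemma Assumptions.tendsto_F (hyp : Assumptions F f D) {ι : Type*} {l : Filter ι}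
    {x p : ι → Space N} {x₀ p₀ : Space N}
    (hx : Tendsto x l (𝓝 x₀)) (hp : Tendsto p l (𝓝 p₀)) (i : Fin m) :
    Tendsto (fun n => F i (x n) (p n)) l (𝓝 (F i x₀ p₀)) :=
  ((hyp.F_continuous i).tendsto (x₀, p₀)).comp (hx.prodMk_nhds hp)

lemma coupling_add_const (A : Matrix (Fin m) (Fin m) ℝ) (a : Fin m → ℝ) (b : ℝ) (i : Fin m) :
    ∑ j, A i j * (a j + b) = ∑ j, A i j * a j + (∑ j, A i j) * b := by
  rw [Finset.sum_mul, ← Finset.sum_add_distrib]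
  exact Finset.sum_congr rfl fun j _ => by ring

end Assumptions

/-! ### Comparison principle for the evolution system -/

section Comparison

variable {N m : ℕ} {F : Fin m → Space N → Space N → ℝ} {f : Fin m → Space N → ℝ}
  {D : Space N → Matrix (Fin m) (Fin m) ℝ}

lemma deriv_sub_sq (κ s t : ℝ) : deriv (fun r : ℝ => κ * (r - s) ^ 2) t = 2 * κ * (t - s) := by
  have h := (((hasDerivAt_id t).sub_const s).pow 2).const_mul κ
  simp only [id_eq, Nat.cast_ofNat] at h
  refine (h.congr_deriv ?_).deriv
  ring

/-- The subsolution test with a paraboloid centred at `(y, s)`. -/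
lemma IsEvolutionSubsolution.test {u : Space N → ℝ → Fin m → ℝ}
    (hu : IsEvolutionSubsolution F f D u) {g : ℝ → ℝ} (hg : ContDiff ℝ 1 g) (b κ : ℝ)
    (i : Fin m) {x y : Space N} {t s : ℝ} (ht : 0 < t)
    (h : ∀ᶠ q : Space N × ℝ in 𝓝 (x, t),
      u q.1 q.2 i - (b * ‖q.1 - y‖ ^ 2 + κ * (q.2 - s) ^ 2 + g q.2) ≤
        u x t i - (b * ‖x - y‖ ^ 2 + κ * (t - s) ^ 2 + g t)) :
    2 * κ * (t - s) + deriv g t + (F i x ((2 * b) • (x - y)) - f i x)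
      + ∑ j, D x i j * u x t j ≤ 0 := by
  have h1 := hu i (fun q => b * ‖q.1 - y‖ ^ 2 + κ * (q.2 - s) ^ 2 + g q.2)
    ((((contDiff_mul_norm_sub_sq b y).comp contDiff_fst).add (by fun_prop)).add
      (hg.comp contDiff_snd)) x t ht h
  have h2 : deriv (fun r => b * ‖x - y‖ ^ 2 + κ * (r - s) ^ 2 + g r) t =
      2 * κ * (t - s) + deriv g t := by
    rw [deriv_fun_add (by fun_prop) (hg.differentiable (by norm_num) t), deriv_const_add,
      deriv_sub_sq]
  have h3 : gradient (fun z => b * ‖z - y‖ ^ 2 + κ * (t - s) ^ 2 + g t) x = (2 * b) • (x - y) := by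
    have : (fun z => b * ‖z - y‖ ^ 2 + κ * (t - s) ^ 2 + g t) =
        fun z => (κ * (t - s) ^ 2 + g t) + b * ‖z - y‖ ^ 2 := by
      ext z; ring
    rw [this, gradient_add_mul_norm_sub_sq (by fun_prop), gradient_fun_const, zero_add]
  simp only [h2, h3] at h1
  exact h1

/-- The supersolution test with a paraboloid centred at `(x, t)`. -/
lemma IsEvolutionSupersolution.test {v : Space N → ℝ → Fin m → ℝ}
    (hv : IsEvolutionSupersolution F f D v) (b κ : ℝ)
    (i : Fin m) {x y : Space N} {t s : ℝ} (hs : 0 < s)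
    (h : ∀ᶠ q : Space N × ℝ in 𝓝 (y, s),
      v y s i + (b * ‖x - y‖ ^ 2 + κ * (t - s) ^ 2) ≤
      v q.1 q.2 i + (b * ‖x - q.1‖ ^ 2 + κ * (t - q.2) ^ 2)) :
    0 ≤ 2 * κ * (t - s) + (F i y ((2 * b) • (x - y)) - f i y)
      + ∑ j, D y i j * v y s j := by
  have h1 := hv i (fun q => -b * ‖q.1 - x‖ ^ 2 + -κ * (q.2 - t) ^ 2)
    (((contDiff_mul_norm_sub_sq (-b) x).comp contDiff_fst).add (by fun_prop)) y s hs (by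
      filter_upwards [h] with q hq
      rw [norm_sub_rev x, norm_sub_rev x] at hq
      nlinarith [hq])
  have h2 : deriv (fun r => -b * ‖y - x‖ ^ 2 + -κ * (r - t) ^ 2) s = 2 * κ * (t - s) := by
    rw [deriv_const_add, deriv_sub_sq]
    ring
  have h3 : gradient (fun z => -b * ‖z - x‖ ^ 2 + -κ * (s - t) ^ 2) y = (2 * b) • (x - y) := by
    have : (fun z => -b * ‖z - x‖ ^ 2 + -κ * (s - t) ^ 2) =
        fun z => (-κ * (s - t) ^ 2) + -b * ‖z - x‖ ^ 2 := by
      ext z; ring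
    rw [this, gradient_add_mul_norm_sub_sq (by fun_prop), gradient_fun_const, zero_add,
      ← neg_sub x y, smul_neg, ← neg_smul]
    congr 1
    ring
  simp only [h2, h3] at h1
  exact h1

lemma exists_abs_le_of_periodic {u : Space N → ℝ → Fin m → ℝ}
    (hu : Continuous fun q : Space N × ℝ => u q.1 q.2) (hpu : ∀ t, Periodic fun x => u x t)
    (T : ℝ) : ∃ B, 0 ≤ B ∧ ∀ i x, ∀ t ∈ Icc 0 T, |u x t i| ≤ B := by
  obtain ⟨Q, hQ, hk⟩ := exists_isCompact_translate N
  obtain ⟨B, hB0, hB⟩ := exists_common_bound (ι := Fin m)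
    (g := fun i (q : ↥(Q ×ˢ Icc (0 : ℝ) T)) => u q.1.1 q.1.2 i) fun i => by
      obtain ⟨B, hB⟩ := (hQ.prod (isCompact_Icc (a := (0 : ℝ)) (b := T))).exists_bound_of_continuousOn
        (f := fun q : Space N × ℝ => u q.1 q.2 i) ((continuous_apply i).comp hu).continuousOn
      exact ⟨B, fun q => hB q.1 q.2⟩
  refine ⟨B, hB0, fun i x t ht => ?_⟩
  obtain ⟨k, hkx⟩ := hk x
  have := hB i ⟨(x + intVec k, t), hkx, ht⟩
  rwa [show u (x + intVec k) t = u x t from hpu t k x] at this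

/-- Doubling of the space variables, with a fixed penalization of the doubled time variables:
at a maximum of `u_i(x,t) - v_i(x,s) - κ (t-s)² - g(t)` which is interior in time, the two
differential inequalities may be subtracted. -/
lemma Assumptions.exists_doubled_max (hyp : Assumptions F f D) [Nonempty (Fin m)]
    {u v : Space N → ℝ → Fin m → ℝ}
    (hu : Continuous fun q : Space N × ℝ => u q.1 q.2) (hpu : ∀ t, Periodic fun x => u x t)
    (hsub : IsEvolutionSubsolution F f D u)
    (hv : Continuous fun q : Space N × ℝ => v q.1 q.2) (hpv : ∀ t, Periodic fun x => v x t)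
    (hsup : IsEvolutionSupersolution F f D v)
    {T : ℝ} (hT : 0 ≤ T) (κ : ℝ) {g : ℝ → ℝ} (hg : ContDiff ℝ 1 g) :
    ∃ i x, ∃ t ∈ Icc 0 T, ∃ s ∈ Icc 0 T,
      (∀ i' x', ∀ t' ∈ Icc 0 T, ∀ s' ∈ Icc 0 T,
        u x' t' i' - v x' s' i' - κ * (t' - s') ^ 2 - g t' ≤
          u x t i - v x s i - κ * (t - s) ^ 2 - g t) ∧
      (0 < t → t < T → 0 < s → s < T →
        deriv g t + ∑ j, D x i j * u x t j ≤ ∑ j, D x i j * v x s j) := by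
  obtain ⟨Q, hQ, hk⟩ := exists_isCompact_translate N
  obtain ⟨k₀, hk₀⟩ := hk 0
  obtain ⟨Bu, hBu0, hBu⟩ := exists_abs_le_of_periodic hu hpu T
  obtain ⟨Bv, hBv0, hBv⟩ := exists_abs_le_of_periodic hv hpv T
  have huc : ∀ i, Continuous fun q : Space N × ℝ => u q.1 q.2 i := fun i =>
    (continuous_apply i).comp hu
  have hvc : ∀ i, Continuous fun q : Space N × ℝ => v q.1 q.2 i := fun i =>
    (continuous_apply i).comp hv
  have hgc := hg.continuous
  -- the doubled functional and its maxima
  let Φ : ℕ → Fin m → Space N → Space N → ℝ → ℝ → ℝ := fun n i x z t s =>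
    u x t i - v (x + z) s i - n * ‖z‖ ^ 2 - κ * (t - s) ^ 2 - g t
  have hΦc : ∀ n i, Continuous fun q : Space N × Space N × ℝ × ℝ =>
      Φ n i q.1 q.2.1 q.2.2.1 q.2.2.2 := by
    intro n i
    have h1 : Continuous fun q : Space N × Space N × ℝ × ℝ => u q.1 q.2.2.1 i :=
      (huc i).comp (f := fun q : Space N × Space N × ℝ × ℝ => (q.1, q.2.2.1)) (by fun_prop)
    have h2 : Continuous fun q : Space N × Space N × ℝ × ℝ => v (q.1 + q.2.1) q.2.2.2 i :=
      (hvc i).comp (f := fun q : Space N × Space N × ℝ × ℝ => (q.1 + q.2.1, q.2.2.2))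
        (by fun_prop)
    fun_prop
  -- The second point is written `x + z` with `z` in the unit ball. By periodicity `x` may then be
  -- taken in `Q`, which makes the domain compact.
  let S : Set (Space N × Space N × ℝ × ℝ) :=
    Q ×ˢ (Metric.closedBall 0 1 ×ˢ (Icc 0 T ×ˢ Icc 0 T))
  have hS : IsCompact S :=
    hQ.prod ((isCompact_closedBall 0 1).prod (isCompact_Icc.prod isCompact_Icc))
  have h0T : (0 : ℝ) ∈ Icc 0 T := ⟨le_rfl, hT⟩
  have hmax : ∀ n : ℕ, ∃ i, ∃ q ∈ S, ∀ i', ∀ x', ∀ z' ∈ Metric.closedBall (0 : Space N) 1,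
      ∀ t' ∈ Icc 0 T, ∀ s' ∈ Icc 0 T,
      Φ n i' x' z' t' s' ≤ Φ n i q.1 q.2.1 q.2.2.1 q.2.2.2 := by
    intro n
    have h1 : ∀ i, ∃ q ∈ S, ∀ q' ∈ S, Φ n i q'.1 q'.2.1 q'.2.2.1 q'.2.2.2 ≤
        Φ n i q.1 q.2.1 q.2.2.1 q.2.2.2 := fun i =>
      hS.exists_isMaxOn ⟨(0 + intVec k₀, 0, 0, 0), hk₀, by simp, h0T, h0T⟩ (hΦc n i).continuousOn
    choose q hq hqmax using h1
    obtain ⟨i, hi⟩ := Finite.exists_max fun i => Φ n i (q i).1 (q i).2.1 (q i).2.2.1 (q i).2.2.2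
    refine ⟨i, q i, hq i, fun i' x' z' hz' t' ht' s' hs' => ?_⟩
    obtain ⟨k, hkx⟩ := hk x'
    refine le_trans ?_ ((hqmax i' (x' + intVec k, z', t', s') ⟨hkx, hz', ht', hs'⟩).trans (hi i'))
    have e1 : u (x' + intVec k) t' = u x' t' := hpu t' k x'
    have e2 : v (x' + intVec k + z') s' = v (x' + z') s' := by
      rw [add_right_comm]; exact hpv s' k (x' + z')
    simp only [Φ, e1, e2, le_refl]
  choose I q hqS hqmax using hmax
  -- passage to the limit
  let l : Ultrafilter ℕ := hyperfilter ℕ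
  have hl : (l : Filter ℕ) ≤ atTop := by
    rw [← Nat.cofinite_eq_atTop]; exact hyperfilter_le_cofinite
  obtain ⟨i, hi⟩ := exists_eventually_eq_of_finite l I
  obtain ⟨⟨x, z, t, s⟩, ⟨hxQ, -, ht, hs⟩, hlim⟩ :=
    exists_tendsto_of_eventually_mem hS l (Eventually.of_forall hqS)
  have ht : t ∈ Icc 0 T := ht
  have hs : s ∈ Icc 0 T := hs
  have hlx : Tendsto (fun n => (q n).1) l (𝓝 x) := (continuous_fst.tendsto _).comp hlim
  have hlz' : Tendsto (fun n => (q n).2.1) l (𝓝 z) :=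
    ((continuous_fst.comp continuous_snd).tendsto _).comp hlim
  have hlt : Tendsto (fun n => (q n).2.2.1) l (𝓝 t) :=
    ((continuous_fst.comp (continuous_snd.comp continuous_snd)).tendsto _).comp hlim
  have hls : Tendsto (fun n => (q n).2.2.2) l (𝓝 s) :=
    ((continuous_snd.comp (continuous_snd.comp continuous_snd)).tendsto _).comp hlim
  -- Comparison with the value at the origin bounds `n * ‖z_n‖ ^ 2` by a convergent quantity,
  -- whereas it would tend to infinity if the limit of `z_n` were nonzero.
  have hz : z = 0 := by
    have h1 : ∀ n : ℕ, (n : ℝ) * ‖(q n).2.1‖ ^ 2 ≤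
        2 * Bu + 2 * Bv - κ * ((q n).2.2.1 - (q n).2.2.2) ^ 2 - g (q n).2.2.1 + g 0 := by
      intro n
      obtain ⟨-, -, h2, h3⟩ := hqS n
      have h4 := hqmax n (I n) 0 0 (by simp) 0 h0T 0 h0T
      simp only [Φ, add_zero, norm_zero, sub_self] at h4
      have h5 := abs_le.1 (hBu (I n) (q n).1 _ h2)
      have h6 := abs_le.1 (hBv (I n) ((q n).1 + (q n).2.1) _ h3)
      have h7 := abs_le.1 (hBu (I n) 0 0 h0T)
      have h8 := abs_le.1 (hBv (I n) 0 0 h0T)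
      linarith [h5.2, h6.1, h7.1, h8.2]
    have h2 : Tendsto (fun n => 2 * Bu + 2 * Bv - κ * ((q n).2.2.1 - (q n).2.2.2) ^ 2
        - g (q n).2.2.1 + g 0) l (𝓝 (2 * Bu + 2 * Bv - κ * (t - s) ^ 2 - g t + g 0)) :=
      ((tendsto_const_nhds.sub (((hlt.sub hls).pow 2).const_mul κ)).sub
        ((hgc.tendsto t).comp hlt)).add_const _
    by_contra hne
    have h3 : Tendsto (fun n : ℕ => (n : ℝ) * ‖(q n).2.1‖ ^ 2) l atTop :=
      (tendsto_natCast_atTop_atTop.mono_left hl).atTop_mul_pos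
        (pow_pos (norm_pos_iff.2 hne) 2) (hlz'.norm.pow 2)
    exact not_tendsto_nhds_of_tendsto_atTop (tendsto_atTop_mono h1 h3) _ h2
  subst hz
  have hlz : Tendsto (fun n => (q n).1 + (q n).2.1) l (𝓝 x) := by
    simpa using hlx.add hlz'
  have hlu : ∀ j, Tendsto (fun n => u (q n).1 (q n).2.2.1 j) l (𝓝 (u x t j)) := fun j =>
    ((huc j).tendsto (x, t)).comp (hlx.prodMk_nhds hlt)
  have hlv : ∀ j, Tendsto (fun n => v ((q n).1 + (q n).2.1) (q n).2.2.2 j) l (𝓝 (v x s j)) :=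
    fun j => ((hvc j).tendsto (x, s)).comp (hlz.prodMk_nhds hls)
  refine ⟨i, x, t, ht, s, hs, fun i' x' t' ht' s' hs' => ?_, fun ht0 htT hs0 hsT => ?_⟩
  · have h1 : Tendsto (fun n => u (q n).1 (q n).2.2.1 i - v ((q n).1 + (q n).2.1) (q n).2.2.2 i
        - κ * ((q n).2.2.1 - (q n).2.2.2) ^ 2 - g (q n).2.2.1) l
        (𝓝 (u x t i - v x s i - κ * (t - s) ^ 2 - g t)) :=
      (((hlu i).sub (hlv i)).sub (((hlt.sub hls).pow 2).const_mul κ)).sub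
        ((hgc.tendsto t).comp hlt)
    refine ge_of_tendsto h1 ?_
    filter_upwards [hi] with n hn
    have h2 := hqmax n i' x' 0 (by simp) t' ht' s' hs'
    simp only [Φ, add_zero, norm_zero, hn] at h2
    have h3 : 0 ≤ (n : ℝ) * ‖(q n).2.1‖ ^ 2 := by positivity
    linarith
  · -- the two tests
    set p : ℕ → Space N := fun n => (2 * (n : ℝ)) • ((q n).1 - ((q n).1 + (q n).2.1))
    have hz1 : ∀ᶠ n in (l : Filter ℕ), (q n).2.1 ∈ Metric.ball (0 : Space N) 1 :=
      hlz'.eventually (Metric.ball_mem_nhds 0 one_pos)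
    have htI : ∀ᶠ n in (l : Filter ℕ), (q n).2.2.1 ∈ Ioo 0 T :=
      hlt.eventually (Ioo_mem_nhds ht0 htT)
    have hsI : ∀ᶠ n in (l : Filter ℕ), (q n).2.2.2 ∈ Ioo 0 T :=
      hls.eventually (Ioo_mem_nhds hs0 hsT)
    have hSub : ∀ᶠ n in (l : Filter ℕ),
        2 * κ * ((q n).2.2.1 - (q n).2.2.2) + deriv g (q n).2.2.1 +
          (F i (q n).1 (p n) - f i (q n).1) + ∑ j, D (q n).1 i j * u (q n).1 (q n).2.2.1 j ≤ 0 := by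
      filter_upwards [hi, hz1, htI, hsI] with n hn hz1 htI hsI
      refine hsub.test hg (n : ℝ) κ i htI.1 ?_
      have hev : ∀ᶠ r : Space N × ℝ in 𝓝 ((q n).1, (q n).2.2.1),
          r.2 ∈ Ioo 0 T ∧ ((q n).1 + (q n).2.1) - r.1 ∈ Metric.ball (0 : Space N) 1 := by
        refine ((continuous_snd.tendsto _).eventually (Ioo_mem_nhds htI.1 htI.2)).and ?_
        refine ((show Continuous fun r : Space N × ℝ => ((q n).1 + (q n).2.1) - r.1 by
          fun_prop).tendsto _).eventually (Metric.isOpen_ball.mem_nhds ?_)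
        simpa using hz1
      filter_upwards [hev] with r hr
      have h2 := hqmax n i r.1 _ (Metric.ball_subset_closedBall hr.2) r.2 ⟨hr.1.1.le, hr.1.2.le⟩
        _ ⟨hsI.1.le, hsI.2.le⟩
      simp only [Φ, hn, add_sub_cancel] at h2
      rw [norm_sub_rev r.1, norm_sub_rev (q n).1, add_sub_cancel_left]
      linarith
    have hSup : ∀ᶠ n in (l : Filter ℕ),
        0 ≤ 2 * κ * ((q n).2.2.1 - (q n).2.2.2) +
          (F i ((q n).1 + (q n).2.1) (p n) - f i ((q n).1 + (q n).2.1)) +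
          ∑ j, D ((q n).1 + (q n).2.1) i j * v ((q n).1 + (q n).2.1) (q n).2.2.2 j := by
      filter_upwards [hi, hz1, htI, hsI] with n hn hz1 htI hsI
      refine hsup.test (n : ℝ) κ i hsI.1 ?_
      have hev : ∀ᶠ r : Space N × ℝ in 𝓝 ((q n).1 + (q n).2.1, (q n).2.2.2),
          r.2 ∈ Ioo 0 T ∧ r.1 - (q n).1 ∈ Metric.ball (0 : Space N) 1 := by
        refine ((continuous_snd.tendsto ((q n).1 + (q n).2.1, (q n).2.2.2)).eventually
          (Ioo_mem_nhds hsI.1 hsI.2)).and ?_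
        refine ((show Continuous fun r : Space N × ℝ => r.1 - (q n).1 by
          fun_prop).tendsto _).eventually (Metric.isOpen_ball.mem_nhds ?_)
        simpa using hz1
      filter_upwards [hev] with r hr
      have h2 := hqmax n i (q n).1 _ (Metric.ball_subset_closedBall hr.2) _ ⟨htI.1.le, htI.2.le⟩
        r.2 ⟨hr.1.1.le, hr.1.2.le⟩
      simp only [Φ, hn, add_sub_cancel] at h2
      rw [norm_sub_rev _ r.1, norm_sub_rev (q n).1, add_sub_cancel_left]
      linarith
    have hτ : Tendsto (fun n => 2 * κ * ((q n).2.2.1 - (q n).2.2.2)) l (𝓝 (2 * κ * (t - s))) :=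
      (hlt.sub hls).const_mul _
    have hdg : Tendsto (fun n => deriv g (q n).2.2.1) l (𝓝 (deriv g t)) :=
      ((hg.continuous_deriv (by norm_num)).tendsto t).comp hlt
    have hf : ∀ {y : ℕ → Space N}, Tendsto y l (𝓝 x) → Tendsto (fun n => f i (y n)) l (𝓝 (f i x)) :=
      fun hy => ((hyp.f_continuous i).tendsto x).comp hy
    have hDu := hyp.tendsto_coupling hlx hlu i
    have hDv := hyp.tendsto_coupling hlz hlv i
    -- the gradients stay bounded by coercivity
    obtain ⟨R, hR⟩ := hyp.exists_norm_le
      (-(2 * κ * (t - s) + deriv g t - f i x + ∑ j, D x i j * u x t j) + 1)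
    have hpR : ∀ᶠ n in (l : Filter ℕ), p n ∈ Metric.closedBall (0 : Space N) R := by
      have h1 := (((hτ.add hdg).sub (hf hlx)).add hDu).eventually (lt_mem_nhds (sub_one_lt _))
      filter_upwards [hSub, h1] with n h2 h3
      rw [mem_closedBall_zero_iff]
      refine hR i (q n).1 (p n) ?_
      linarith
    obtain ⟨p₀, -, hp₀⟩ := exists_tendsto_of_eventually_mem (isCompact_closedBall _ _) l hpR
    have h1 := le_of_tendsto (((hτ.add hdg).add ((hyp.tendsto_F hlx hp₀ i).sub (hf hlx))).add hDu)
      hSub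
    have h2 := ge_of_tendsto ((hτ.add ((hyp.tendsto_F hlz hp₀ i).sub (hf hlz))).add hDv) hSup
    -- Both limiting inequalities contain the same `F i x p₀ - f i x` and the same `2 * κ * (t -
    -- s)`, which cancel.
    linarith

lemma exists_time_modulus {u : Space N → ℝ → Fin m → ℝ}
    (hu : Continuous fun q : Space N × ℝ => u q.1 q.2) (hpu : ∀ t, Periodic fun x => u x t)
    (T : ℝ) {ε : ℝ} (hε : 0 < ε) : ∃ ρ > 0, ∀ i x, ∀ t ∈ Icc 0 T, ∀ s ∈ Icc 0 T,
      |t - s| < ρ → |u x t i - u x s i| ≤ ε := by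
  obtain ⟨Q, hQ, hk⟩ := exists_isCompact_translate N
  have h1 := (hQ.prod (isCompact_Icc (a := (0 : ℝ)) (b := T))).uniformContinuousOn_of_continuous
    hu.continuousOn
  obtain ⟨ρ, hρ, h⟩ := Metric.uniformContinuousOn_iff.1 h1 ε hε
  refine ⟨ρ, hρ, fun i x t ht s hs hts => ?_⟩
  obtain ⟨k, hkx⟩ := hk x
  have h2 := h (x + intVec k, t) ⟨hkx, ht⟩ (x + intVec k, s) ⟨hkx, hs⟩
    (by simpa [Prod.dist_eq, Real.dist_eq, hρ] using hts)
  simp only at h2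
  rw [show u (x + intVec k) t = u x t from hpu t k x,
    show u (x + intVec k) s = u x s from hpu s k x] at h2
  exact ((dist_le_pi_dist (u x t) (u x s) i).trans h2.le)

/-- At a doubled maximum the index `i` maximizes `u x t j - v x s j` over `j`, and this difference
is positive, so the coupling terms have the favourable sign. The strictly increasing `g` then
contradicts the subtracted inequalities. -/
lemma Assumptions.comparison_of_continuous (hyp : Assumptions F f D)
    {u v : Space N → ℝ → Fin m → ℝ}
    (hu : Continuous fun q : Space N × ℝ => u q.1 q.2) (hpu : ∀ t, Periodic fun x => u x t)
    (hsub : IsEvolutionSubsolution F f D u)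
    (hv : Continuous fun q : Space N × ℝ => v q.1 q.2) (hpv : ∀ t, Periodic fun x => v x t)
    (hsup : IsEvolutionSupersolution F f D v) (h0 : ∀ x i, u x 0 i ≤ v x 0 i)
    {x₁ : Space N} {t₁ : ℝ} (ht₁ : 0 ≤ t₁) (i₁ : Fin m) : u x₁ t₁ i₁ ≤ v x₁ t₁ i₁ := by
  by_contra! hlt
  have : Nonempty (Fin m) := ⟨i₁⟩
  set θ := u x₁ t₁ i₁ - v x₁ t₁ i₁ with hθdef
  have hθ : 0 < θ := sub_pos.2 hlt
  set T := t₁ + 2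
  have hT : 0 ≤ T := by positivity
  obtain ⟨Bu, hBu0, hBu⟩ := exists_abs_le_of_periodic hu hpu T
  obtain ⟨Bv, hBv0, hBv⟩ := exists_abs_le_of_periodic hv hpv T
  obtain ⟨ρu, hρu0, hρu⟩ := exists_time_modulus hu hpu T (show 0 < θ / 8 by positivity)
  obtain ⟨ρv, hρv0, hρv⟩ := exists_time_modulus hv hpv T (show 0 < θ / 8 by positivity)
  -- Below the moduli `ρu`, `ρv`, one of the two times being `0` would make the maximum too small.
  -- The bound by `1` keeps `s` below `T = t₁ + 2` once `t < t₁ + 1`. The choice of `κ` makes the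
  -- penalty exceed `B` for `|t - s| ≥ ρ`.
  set ρ := min (min ρu ρv) 1
  have hρ : 0 < ρ := by positivity
  set B := Bu + Bv
  set κ := (B + 1) / ρ ^ 2
  have hκ : κ * ρ ^ 2 = B + 1 := div_mul_cancel₀ _ (by positivity)
  have hκ0 : 0 < κ := by positivity
  set A := 2 * (B + 1) / θ
  have hA : 0 < A := by positivity
  -- This function costs only `θ / 2` at `t₁`, has positive derivative, and exceeds `B` from `t₁ +
  -- 1` on, which keeps the maximum away from the final time.
  set g : ℝ → ℝ := fun t => θ / 2 * Real.exp (A * (t - t₁)) with hgdef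
  have hg : ContDiff ℝ 1 g := by fun_prop
  have hgpos : ∀ t, 0 < g t := fun t => by positivity
  have hg' : ∀ t, 0 < deriv g t := by
    intro t
    have h1 : HasDerivAt (fun t => A * (t - t₁)) A t := by
      simpa using ((hasDerivAt_id t).sub_const t₁).const_mul A
    rw [(h1.exp.const_mul (θ / 2)).deriv]
    positivity
  have hgbig : ∀ t, t₁ + 1 ≤ t → B < g t := by
    intro t ht
    have h1 : A ≤ A * (t - t₁) := by nlinarith
    have h2 := Real.add_one_le_exp (A * (t - t₁))
    have h3 : θ / 2 * A = B + 1 := by simp only [A]; field_simp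
    have h4 : θ / 2 * (A + 1) ≤ g t := mul_le_mul_of_nonneg_left (by linarith) (by positivity)
    nlinarith
  obtain ⟨i, x, t, ht, s, hs, hmax, hineq⟩ :=
    hyp.exists_doubled_max hu hpu hsub hv hpv hsup hT κ hg
  have hM : θ / 2 ≤ u x t i - v x s i - κ * (t - s) ^ 2 - g t := by
    have h1 : t₁ ∈ Icc 0 T := ⟨ht₁, by simp [T]⟩
    have h2 := hmax i₁ x₁ t₁ h1 t₁ h1
    have h3 : g t₁ = θ / 2 := by simp [hgdef]
    rw [h3] at h2
    simp only [sub_self] at h2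
    linarith
  have hB1 : u x t i - v x s i ≤ B := by
    have := abs_le.1 (hBu i x t ht)
    have := abs_le.1 (hBv i x s hs)
    linarith
  have hpen0 : 0 ≤ κ * (t - s) ^ 2 := by positivity
  have hts : |t - s| < ρ := by
    have h1 : κ * (t - s) ^ 2 < κ * ρ ^ 2 := by linarith [hgpos t]
    exact abs_lt_of_sq_lt_sq (lt_of_mul_lt_mul_left h1 hκ0.le) hρ.le
  have hts' := abs_lt.1 hts
  have hρ1 : ρ ≤ 1 := min_le_right _ _
  have hρρu : ρ ≤ ρu := (min_le_left _ _).trans (min_le_left _ _)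
  have hρρv : ρ ≤ ρv := (min_le_left _ _).trans (min_le_right _ _)
  have htlt : t < t₁ + 1 := by
    by_contra! h
    linarith [hgbig t h]
  have h0T : (0 : ℝ) ∈ Icc 0 T := ⟨le_rfl, hT⟩
  have ht0 : 0 < t := by
    rcases ht.1.eq_or_lt with h | h
    · exfalso
      have h1 := abs_le.1 (hρv i x 0 h0T s hs (by rw [h]; linarith))
      rw [← h] at hM
      have h2 := h0 x i
      have h3 := hgpos 0
      rw [← h] at hpen0
      linarith
    · exact h
  have hs0 : 0 < s := by
    rcases hs.1.eq_or_lt with h | h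
    · exfalso
      have h1 := abs_le.1 (hρu i x t ht 0 h0T (by rw [h]; linarith))
      rw [← h] at hM hpen0
      have h2 := h0 x i
      have h3 := hgpos t
      linarith
    · exact h
  have h1 := hineq ht0 (by simp only [T]; linarith) hs0 (by simp only [T]; linarith)
  have h2 : ∀ j, u x t j - v x s j ≤ u x t i - v x s i := fun j => by
    linarith [hmax j x t ht s hs]
  have h3 := hyp.coupling_nonneg x (i := i) (a := fun j => u x t j - v x s j) h2
    (by linarith [hgpos t])
  simp only [mul_sub, Finset.sum_sub_distrib] at h3
  linarith [hg' t]

/-- The function `u`, frozen at negative times. -/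
def clamp (u : Space N → ℝ → Fin m → ℝ) : Space N → ℝ → Fin m → ℝ := fun x t => u x (max t 0)

lemma clamp_eventuallyEq (u : Space N → ℝ → Fin m → ℝ) (x : Space N) {t : ℝ} (ht : 0 < t) :
    ∀ᶠ q : Space N × ℝ in 𝓝 (x, t), clamp u q.1 q.2 = u q.1 q.2 := by
  have h : ∀ᶠ q : Space N × ℝ in 𝓝 (x, t), 0 < q.2 :=
    continuous_snd.continuousAt.eventually (lt_mem_nhds ht)
  filter_upwards [h] with q hq
  simp [clamp, max_eq_left hq.le]

lemma continuous_clamp {u : Space N → ℝ → Fin m → ℝ}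
    (hu : ContinuousOn (fun q : Space N × ℝ => u q.1 q.2) (univ ×ˢ Ici 0)) :
    Continuous fun q : Space N × ℝ => clamp u q.1 q.2 :=
  hu.comp_continuous (f := fun q : Space N × ℝ => (q.1, max q.2 0)) (by fun_prop)
    fun q => ⟨mem_univ _, le_max_right q.2 0⟩

lemma IsEvolutionSubsolution.clamp {u : Space N → ℝ → Fin m → ℝ}
    (hu : IsEvolutionSubsolution F f D u) : IsEvolutionSubsolution F f D (clamp u) := by
  intro i φ hφ x t ht hmax
  have h1 := hu i φ hφ x t ht (hmax.congr (by
    filter_upwards [clamp_eventuallyEq u x ht] with q hq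
    rw [hq]))
  rwa [(clamp_eventuallyEq u x ht).self_of_nhds]

lemma IsEvolutionSupersolution.clamp {u : Space N → ℝ → Fin m → ℝ}
    (hu : IsEvolutionSupersolution F f D u) : IsEvolutionSupersolution F f D (clamp u) := by
  intro i φ hφ x t ht hmin
  have h1 := hu i φ hφ x t ht (hmin.congr (by
    filter_upwards [clamp_eventuallyEq u x ht] with q hq
    rw [hq]))
  rwa [(clamp_eventuallyEq u x ht).self_of_nhds]

/-- Comparison principle for the evolution system. -/
theorem Assumptions.comparison (hyp : Assumptions F f D) {u v : Space N → ℝ → Fin m → ℝ}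
    (hu : ContinuousOn (fun q : Space N × ℝ => u q.1 q.2) (univ ×ˢ Ici 0))
    (hpu : ∀ t, 0 ≤ t → Periodic fun x => u x t) (hsub : IsEvolutionSubsolution F f D u)
    (hv : ContinuousOn (fun q : Space N × ℝ => v q.1 q.2) (univ ×ˢ Ici 0))
    (hpv : ∀ t, 0 ≤ t → Periodic fun x => v x t) (hsup : IsEvolutionSupersolution F f D v)
    (h0 : ∀ x i, u x 0 i ≤ v x 0 i) {x : Space N} {t : ℝ} (ht : 0 ≤ t) (i : Fin m) :
    u x t i ≤ v x t i := by
  have h := hyp.comparison_of_continuous (continuous_clamp hu)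
    (fun t => hpu (max t 0) (le_max_right _ _)) hsub.clamp (continuous_clamp hv)
    (fun t => hpv (max t 0) (le_max_right _ _)) hsup.clamp
    (by simpa [HJSystem.clamp] using h0) (x₁ := x) ht i
  simpa [HJSystem.clamp, max_eq_left ht] using h

end Comparison

/-! ### Perron's method for systems with positive row sums -/

section Perron

variable {N m : ℕ} {F : Fin m → Space N → Space N → ℝ} {f : Fin m → Space N → ℝ}
  {D : Space N → Matrix (Fin m) (Fin m) ℝ} {c : Fin m → ℝ}

/-- A bounded subsolution is Lipschitz continuous, by coercivity. -/
lemma IsStationarySubsolution.lipschitzWith {v : Space N → Fin m → ℝ}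
    (hsub : IsStationarySubsolution F f D c v) (hv : Continuous v) {B M : ℝ}
    (hB : ∀ x i, |v x i| ≤ B) {i : Fin m}
    (hM : ∀ x, f i x + c i - ∑ j, D x i j * v x j ≤ M) {R : NNReal}
    (hR : ∀ i x p, F i x p ≤ M → ‖p‖ ≤ R) : LipschitzWith R fun x => v x i := by
  refine lipschitzWith_of_norm_gradient_le ((continuous_apply i).comp hv) (fun x => hB x i) ?_
  intro φ hφ x hmax
  refine hR i x _ ?_
  linarith [hsub i φ hφ x hmax, hM x]

lemma IsStationarySubsolution.translate (hyp : Assumptions F f D) {v : Space N → Fin m → ℝ}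
    (hsub : IsStationarySubsolution F f D c v) (k : Fin N → ℤ) :
    IsStationarySubsolution F f D c fun x => v (x + intVec k) := by
  intro i φ hφ x hmax
  have h1 := hsub i (fun y => φ (y - intVec k)) (hφ.comp (by fun_prop)) (x + intVec k) (by
    have h2 : Tendsto (fun y : Space N => y - intVec k) (𝓝 (x + intVec k)) (𝓝 x) := by
      have : Continuous fun y : Space N => y - intVec k := by fun_prop
      simpa using this.tendsto (x + intVec k)
    filter_upwards [h2.eventually hmax] with y hy
    simpa using hy)
  have h3 : gradient (fun y => φ (y - intVec k)) (x + intVec k) = gradient φ x := by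
    simp only [gradient, fderiv_comp_sub, add_sub_cancel_right]
  have h4 : F i (x + intVec k) (gradient φ x) = F i x (gradient φ x) := hyp.F_periodic i _ k x
  have h5 : f i (x + intVec k) = f i x := hyp.f_periodic i k x
  have h6 : D (x + intVec k) = D x := hyp.D_periodic k x
  rwa [h3, h4, h5, h6] at h1

variable (F f D) in
/-- The nonnegative continuous subsolutions bounded by `B`. They need not be periodic. -/
def perronClass (B : ℝ) : Set (Space N → Fin m → ℝ) :=
  {w | Continuous w ∧ (∀ x i, 0 ≤ w x i ∧ w x i ≤ B) ∧ IsStationarySubsolution F f D 0 w}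

variable (F f D) in
/-- The largest subsolution with values between `0` and `B`. -/
noncomputable def perronSup (B : ℝ) (x : Space N) (i : Fin m) : ℝ :=
  ⨆ w : perronClass F f D B, w.1 x i

lemma Assumptions.zero_mem_perronClass (hyp : Assumptions F f D) {B : ℝ} (hB : 0 ≤ B) :
    0 ∈ perronClass F f D B := by
  refine ⟨continuous_const, fun x i => ⟨le_rfl, hB⟩, fun i φ hφ x hmax => ?_⟩
  have h0 : gradient φ x = 0 := by
    rw [← gradient_eq_of_isLocalMax_sub (φ := fun _ => (0 : ℝ)) (by fun_prop)
      (hφ.differentiable (by norm_num) x) hmax, gradient_fun_const]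
  simp only [h0, hyp.F_zero, Pi.zero_apply, mul_zero, Finset.sum_const_zero]
  linarith [hyp.f_nonneg i x]

lemma le_perronSup {B : ℝ} {w : Space N → Fin m → ℝ} (hw : w ∈ perronClass F f D B)
    (x : Space N) (i : Fin m) : w x i ≤ perronSup F f D B x i :=
  le_ciSup (f := fun w : perronClass F f D B => w.1 x i)
    ⟨B, by rintro _ ⟨w, rfl⟩; exact (w.2.2.1 x i).2⟩ ⟨w, hw⟩

lemma Assumptions.perronSup_le (hyp : Assumptions F f D) {B b : ℝ} (hB : 0 ≤ B) {x : Space N}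
    {i : Fin m} (h : ∀ w ∈ perronClass F f D B, w x i ≤ b) : perronSup F f D B x i ≤ b := by
  have : Nonempty (perronClass F f D B) := ⟨⟨0, hyp.zero_mem_perronClass hB⟩⟩
  exact ciSup_le fun w => h w.1 w.2

lemma Assumptions.exists_lipschitz_perronClass (hyp : Assumptions F f D) (B : ℝ) :
    ∃ R : NNReal, ∀ w ∈ perronClass F f D B, ∀ i, LipschitzWith R fun x => w x i := by
  obtain ⟨A, hA0, hA⟩ := hyp.exists_f_le
  obtain ⟨A', hA'0, hA'⟩ := hyp.exists_abs_coupling_le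
  obtain ⟨R, hR⟩ := hyp.exists_norm_le (A + A' * B)
  refine ⟨R, fun w hw i => ?_⟩
  have habs : ∀ x i, |w x i| ≤ B := fun x i => by
    rw [abs_of_nonneg (hw.2.1 x i).1]; exact (hw.2.1 x i).2
  refine hw.2.2.lipschitzWith hw.1 habs (fun x => ?_) hR
  simp only [Pi.zero_apply, add_zero]
  linarith [hA i x, (abs_le.1 (hA' x i (w x) B (habs x))).1]

lemma Assumptions.exists_lipschitz_perronSup (hyp : Assumptions F f D) {B : ℝ} (hB : 0 ≤ B) :
    ∃ R : NNReal, ∀ i, LipschitzWith R fun x => perronSup F f D B x i := by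
  obtain ⟨R, hR⟩ := hyp.exists_lipschitz_perronClass B
  refine ⟨R, fun i => LipschitzWith.of_le_add_mul R fun x y => ?_⟩
  refine hyp.perronSup_le hB fun w hw => ?_
  have h1 := (hR w hw i).dist_le_mul x y
  rw [Real.dist_eq] at h1
  linarith [(abs_le.1 h1).2, le_perronSup hw y i]

/-- Raising a function on one ball destroys periodicity, so the class does not require it. The class
is invariant under integer translations, and its supremum inherits that invariance. -/
lemma Assumptions.periodic_perronSup (hyp : Assumptions F f D) {B : ℝ} (hB : 0 ≤ B) :
    Periodic (perronSup F f D B) := by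
  have key : ∀ (k : Fin N → ℤ) x i,
      perronSup F f D B (x + intVec k) i ≤ perronSup F f D B x i := fun k x i =>
    hyp.perronSup_le hB fun w hw => le_perronSup (w := fun x => w (x + intVec k))
      ⟨hw.1.comp (by fun_prop), fun x i => hw.2.1 _ i, hw.2.2.translate hyp k⟩ x i
  intro k x
  ext i
  refine le_antisymm (key k x i) ?_
  have h := key (-k) (x + intVec k) i
  have h0 : x + intVec k + intVec (-k) = x := by
    ext n; simp
  rwa [h0] at h

/-- Members of the class nearly attaining the supremum at `x` are equi-Lipschitz, so the test
function, slightly perturbed, touches them from above near `x`. Replacing their other components by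
the supremum only lowers the coupling term. -/
lemma Assumptions.perronSup_isSubsolution (hyp : Assumptions F f D) {B : ℝ} (hB : 0 ≤ B) :
    IsStationarySubsolution F f D 0 (perronSup F f D B) := by
  intro i φ hφ x hmax
  set v := perronSup F f D B
  obtain ⟨R, hR⟩ := hyp.exists_lipschitz_perronClass B
  obtain ⟨R', hR'⟩ := hyp.exists_lipschitz_perronSup hB
  have hvc : ∀ j, Continuous fun x => v x j := fun j => (hR' j).continuous
  have hseq : ∀ n : ℕ, ∃ w ∈ perronClass F f D B, v x i - 1 / ((n : ℝ) + 1) < w x i := by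
    intro n
    have : Nonempty (perronClass F f D B) := ⟨⟨0, hyp.zero_mem_perronClass hB⟩⟩
    obtain ⟨w, hw⟩ := exists_lt_of_lt_ciSup
      (show v x i - 1 / ((n : ℝ) + 1) < ⨆ w : perronClass F f D B, w.1 x i from
        sub_lt_self _ (by positivity))
    exact ⟨w.1, w.2, hw⟩
  choose w hw hwx using hseq
  let l : Ultrafilter ℕ := hyperfilter ℕ
  have hl : (l : Filter ℕ) ≤ atTop := by
    rw [← Nat.cofinite_eq_atTop]; exact hyperfilter_le_cofinite
  have hlim : Tendsto (fun n => w n x i) l (𝓝 (v x i)) := by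
    have h1 : Tendsto (fun n : ℕ => v x i - 1 / ((n : ℝ) + 1)) l (𝓝 (v x i)) := by
      simpa using (tendsto_one_div_add_atTop_nhds_zero_nat.mono_left hl).const_sub (v x i)
    exact tendsto_of_tendsto_of_tendsto_of_le_of_le h1 tendsto_const_nhds (fun n => (hwx n).le)
      fun n => le_perronSup (hw n) x i
  obtain ⟨ψ, y, hψ, hy, hymax, hgrad, hwy⟩ := exists_tendsto_isLocalMax l
    (w := fun n z => w n z i) (v := fun z => v z i) (fun n => hR _ (hw n) i) hφ hmax hlim
    fun z ε hε => Eventually.of_forall fun n => by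
      linarith [le_perronSup (hw n) z i]
  have hvy : ∀ j, Tendsto (fun n => v (y n) j) l (𝓝 (v x j)) := fun j =>
    ((hvc j).tendsto x).comp hy
  -- Only component `i` of `w n` is known to converge to `v`. The other components are those of `v`
  -- itself, so the diagonal term is split off.
  have hlimit := ((((hyp.tendsto_F hy hgrad i).sub (((hyp.f_continuous i).tendsto x).comp hy)).add
    (hyp.tendsto_coupling hy hvy i)).sub
      ((((hyp.D_continuous i i).tendsto x).comp hy).mul (hvy i))).add
      ((((hyp.D_continuous i i).tendsto x).comp hy).mul hwy)
  have h1 := le_of_tendsto hlimit (b := 0) (by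
    filter_upwards [hymax] with n hn
    have h2 := (hw n).2.2 i ψ hψ (y n) hn
    have h3 := hyp.coupling_mono (y n) (i := i) fun j => le_perronSup (hw n) (y n) j
    simp only [Pi.zero_apply] at h2
    simp only [Function.comp_apply]
    linarith)
  simp only [Pi.zero_apply]
  linarith

/-- If `v` is a subsolution which fails the supersolution property at `x` in component `i`, it may
be raised near `x`. -/
lemma Assumptions.exists_bump (hyp : Assumptions F f D) {B : ℝ} {v : Space N → Fin m → ℝ}
    (hv : v ∈ perronClass F f D B) {i : Fin m} {φ : Space N → ℝ} (hφ : ContDiff ℝ 1 φ)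
    {x : Space N} (hmin : IsLocalMin (fun y => v y i - φ y) x) (hvx : v x i < B)
    (hlt : F i x (gradient φ x) - f i x + ∑ j, D x i j * v x j < 0) :
    ∃ w ∈ perronClass F f D B, v x i < w x i := by
  obtain ⟨hvcont, hvB, hvsub⟩ := hv
  have hvc : ∀ j, Continuous fun y => v y j := fun j => (continuous_apply j).comp hvcont
  -- Normalized to agree with `v` at `x`; near `x`, `v y i` exceeds `ψ y` by at least `‖y - x‖ ^ 2`.
  set ψ : Space N → ℝ := fun y => (φ y + (v x i - φ x)) + -1 * ‖y - x‖ ^ 2 with hψdef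
  have hψ : ContDiff ℝ 1 ψ := (hφ.add contDiff_const).add (contDiff_mul_norm_sub_sq _ x)
  have hψx : ψ x = v x i := by simp [hψdef]
  have hψg : gradient ψ x = gradient φ x := by
    rw [hψdef, gradient_add_mul_norm_sub_sq ((hφ.differentiable (by norm_num) x).add_const _)]
    simp only [gradient, fderiv_add_const, sub_self, smul_zero, add_zero]
  -- The left-hand side of equation `i` with `ψ` in place of `v i` and the other components
  -- unchanged.
  set G : Space N → ℝ := fun y => F i y (gradient ψ y) - f i y + ∑ j, D y i j * v y j +
    D y i i * (ψ y - v y i) with hGdef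
  have hGc : Continuous G := by
    have h1 : Continuous fun y => F i y (gradient ψ y) :=
      (hyp.F_continuous i).comp (continuous_id.prodMk (continuous_gradient hψ))
    exact ((h1.sub (hyp.f_continuous i)).add (hyp.continuous_coupling continuous_id hvc i)).add
      ((hyp.D_continuous i i).mul (hψ.continuous.sub (hvc i)))
  have hGx : G x < 0 := by
    simp only [hGdef, hψg, hψx, sub_self, mul_zero, add_zero]
    exact hlt
  obtain ⟨A, hA0, hA⟩ := hyp.exists_D_le
  have hev : ∀ᶠ y in 𝓝 x, G y < G x / 2 ∧ ψ y < (v x i + B) / 2 ∧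
      v x i - φ x ≤ v y i - φ y :=
    (hGc.continuousAt.eventually_lt_const (by linarith)).and
      ((hψ.continuous.continuousAt.eventually_lt_const (by rw [hψx]; linarith)).and hmin)
  obtain ⟨r, hr, hball⟩ := Metric.nhds_basis_ball.mem_iff.1 hev
  -- The three bounds preserve the strict inequality `G < 0` after adding `D y i i * η`, keep `ψ +
  -- η` below `v i` outside the ball of radius `r / 2`, and keep it below `B`.
  set η : ℝ := min (min (-G x / (2 * (A + 1))) (r ^ 2 / 8)) ((B - v x i) / 2)
  have hη : 0 < η := by
    refine lt_min (lt_min ?_ (by positivity)) (by linarith)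
    have : 0 < -G x := by linarith
    positivity
  have hη1 : A * η ≤ -G x / 2 := by
    have h1 : η ≤ -G x / (2 * (A + 1)) := (min_le_left _ _).trans (min_le_left _ _)
    rw [le_div_iff₀ (by positivity)] at h1
    nlinarith
  have hη2 : η ≤ r ^ 2 / 8 := (min_le_left _ _).trans (min_le_right _ _)
  have hη3 : η ≤ (B - v x i) / 2 := min_le_right _ _
  -- the raised component
  classical
  set z : Space N → ℝ := fun y => if y ∈ Metric.ball x r then max (v y i) (ψ y + η) else v y i
    with hzdef
  have hzv : ∀ y, v y i ≤ z y := fun y => by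
    simp only [hzdef]; split_ifs <;> simp
  have hzin : ∀ y ∈ Metric.ball x r, z y = max (v y i) (ψ y + η) := fun y hy => by
    simp only [hzdef, hy, if_true]
  have hzout : ∀ y, r / 2 < ‖y - x‖ → z y = v y i := by
    intro y hy
    by_cases hyr : y ∈ Metric.ball x r
    · rw [hzin y hyr, max_eq_left]
      have h1 := (hball hyr).2.2
      have h2 : (r / 2) ^ 2 < ‖y - x‖ ^ 2 := by gcongr
      simp only [hψdef]
      nlinarith
    · simp only [hzdef, hyr, if_false]
  have hzc : Continuous z := by
    refine continuous_iff_continuousAt.2 fun y => ?_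
    by_cases hyr : y ∈ Metric.ball x r
    · have h1 : z =ᶠ[𝓝 y] fun y => max (v y i) (ψ y + η) := by
        filter_upwards [Metric.isOpen_ball.mem_nhds hyr] with y hy using hzin y hy
      exact (((hvc i).max (hψ.continuous.add continuous_const)).continuousAt).congr h1.symm
    · have hlt : r / 2 < ‖y - x‖ := by
        rw [mem_ball_iff_norm, not_lt] at hyr
        linarith
      have h1 : z =ᶠ[𝓝 y] fun y => v y i := by
        have hc : Continuous fun y : Space N => ‖y - x‖ := by fun_prop
        filter_upwards [(hc.tendsto y).eventually (lt_mem_nhds hlt)] with y hy using hzout y hy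
      exact (hvc i).continuousAt.congr h1.symm
  have hzB : ∀ y, z y ≤ B := by
    intro y
    by_cases hyr : y ∈ Metric.ball x r
    · rw [hzin y hyr]
      exact max_le (hvB y i).2 (by linarith [(hball hyr).2.1])
    · simp only [hzdef, hyr, if_false]
      exact (hvB y i).2
  have hxball : x ∈ Metric.ball x r := Metric.mem_ball_self hr
  set w : Space N → Fin m → ℝ := fun y => Function.update (v y) i (z y) with hwdef
  have hwi : ∀ y, w y i = z y := fun y => Function.update_self ..
  have hwj : ∀ y j, j ≠ i → w y j = v y j := fun y j hj => Function.update_of_ne hj ..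
  have hvw : ∀ y j, v y j ≤ w y j := by
    intro y j
    by_cases hj : j = i
    · subst hj; rw [hwi]; exact hzv y
    · rw [hwj y j hj]
  refine ⟨w, ⟨?_, ?_, ?_⟩, ?_⟩
  · exact hvcont.update i hzc
  · intro y j
    refine ⟨(hvB y j).1.trans (hvw y j), ?_⟩
    by_cases hj : j = i
    · subst hj; rw [hwi]; exact hzB y
    · rw [hwj y j hj]; exact (hvB y j).2
  · intro j χ hχ y hmax
    have hmono := hyp.coupling_mono y (i := j) (hvw y)
    -- Where `w j` agrees with `v j`, a test function touching `w j` also touches `v j`, and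
    -- increasing another component helps. Otherwise `w j = ψ + η` at `y`, and the smooth function
    -- `ψ` gives the inequality classically.
    by_cases hcase : w y j = v y j
    · have h1 := hvsub j χ hχ y (by
        filter_upwards [hmax] with y' hy'
        linarith [hvw y' j])
      rw [hcase] at hmono
      linarith
    · have hj : j = i := by
        by_contra hj
        exact hcase (hwj y j hj)
      subst hj
      rw [hwi] at hcase
      have hyr : y ∈ Metric.ball x r := by
        by_contra hyr
        exact hcase (by simp only [hzdef, hyr, if_false])
      have hzy : z y = ψ y + η := by
        rw [hzin y hyr] at hcase ⊢
        rcases max_choice (v y j) (ψ y + η) with h | h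
        · exact absurd h hcase
        · exact h
      have h1 : gradient ψ y = gradient χ y := by
        refine gradient_eq_of_isLocalMax_sub (hψ.differentiable (by norm_num) y)
          (hχ.differentiable (by norm_num) y) ?_
        filter_upwards [hmax, Metric.isOpen_ball.mem_nhds hyr] with y' hy' hyr'
        rw [hwi, hwi, hzy, hzin y' hyr'] at hy'
        linarith [le_max_right (v y' j) (ψ y' + η)]
      have h2 := (hball hyr).1
      have h3 : D y j j * η ≤ A * η :=
        mul_le_mul_of_nonneg_right ((le_abs_self _).trans (hA y j j)) hη.le
      rw [hwi, hzy] at hmono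
      simp only [hGdef] at h2 hη1
      rw [← h1]
      simp only [Pi.zero_apply]
      nlinarith
  · rw [hwi, hzin x hxball, hψx]
    exact lt_max_of_lt_right (by linarith)

/-- Existence for systems with positive row sums, by Perron's method. -/
theorem Assumptions.exists_solution_of_pos_row (hyp : Assumptions F f D) {lam : ℝ}
    (hlam : 0 < lam) (hrow : ∀ x i, lam ≤ ∑ j, D x i j) :
    ∃ v, IsStationarySolution F f D 0 v ∧ ∀ x i, 0 ≤ v x i := by
  obtain ⟨A, hA0, hA⟩ := hyp.exists_f_le
  -- The constant `B` is a supersolution: its coupling term is at least `lam * B = A ≥ f`.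
  set B := A / lam
  have hB : 0 ≤ B := by positivity
  have hlB : lam * B = A := mul_div_cancel₀ _ hlam.ne'
  set v := perronSup F f D B
  obtain ⟨R, hR⟩ := hyp.exists_lipschitz_perronSup hB
  have hcont : Continuous v := continuous_pi fun i => (hR i).continuous
  have h0 : ∀ x i, 0 ≤ v x i := fun x i => le_perronSup (hyp.zero_mem_perronClass hB) x i
  have hvB : ∀ x i, v x i ≤ B := fun x i => hyp.perronSup_le hB fun w hw => (hw.2.1 x i).2
  have hsub := hyp.perronSup_isSubsolution hB
  have hmem : v ∈ perronClass F f D B := ⟨hcont, fun x i => ⟨h0 x i, hvB x i⟩, hsub⟩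
  refine ⟨v, ⟨hcont, hyp.periodic_perronSup hB, hsub, ?_⟩, h0⟩
  intro i φ hφ x hmin
  simp only [Pi.zero_apply]
  by_contra! hlt
  -- At the upper obstacle the supersolution inequality follows from the choice of `B`; strictly
  -- below it, a failure would allow `v` to be raised, against maximality.
  rcases (hvB x i).eq_or_lt with h | h
  · have h1 : ∑ j, D x i j * B ≤ ∑ j, D x i j * v x j := by
      have := hyp.coupling_mono x (i := i) fun j => hvB x j
      rw [h] at this
      linarith
    rw [← Finset.sum_mul] at h1
    have h2 := mul_le_mul_of_nonneg_right (hrow x i) hB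
    linarith [hyp.F_nonneg i x (gradient φ x), hA i x]
  · obtain ⟨w, hw, hlt⟩ := hyp.exists_bump hmem hφ hmin h hlt
    exact absurd (le_perronSup hw x i) (not_le.2 hlt)

end Perron

/-! ### The ergodic problem by vanishing discount -/

section ErgodicProblem

variable {N m : ℕ} {F : Fin m → Space N → Space N → ℝ} {f : Fin m → Space N → ℝ}
  {D : Space N → Matrix (Fin m) (Fin m) ℝ} {c : Fin m → ℝ}

/-! ### Quantitative irreducibility -/

/-- For fixed `I` the sum of `-D x i j` over pairs leaving `I` is continuous, periodic and positive,
hence bounded below by its positive minimum. There are finitely many pairs and finitely many `I`. -/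
lemma Assumptions.exists_irreducible_const (hyp : Assumptions F f D)
    (hirr : ∀ x, Irreducible (D x)) :
    ∃ δ > 0, ∀ x (I : Set (Fin m)), I.Nonempty → I ≠ univ → ∃ i ∈ I, ∃ j ∉ I, δ ≤ -D x i j := by
  classical
  have hone : ∀ I : Set (Fin m), ∃ δ > 0, I.Nonempty → I ≠ univ →
      ∀ x, ∃ i ∈ I, ∃ j ∉ I, δ ≤ -D x i j := by
    intro I
    by_cases hI : I.Nonempty ∧ I ≠ univ
    swap
    · exact ⟨1, one_pos, fun h1 h2 => absurd ⟨h1, h2⟩ hI⟩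
    let h : Fin m × Fin m → Space N → ℝ := fun q x =>
      if q.1 ∈ I ∧ q.2 ∉ I then -D x q.1 q.2 else 0
    have hhc : ∀ q, Continuous (h q) := by
      intro q
      by_cases hq : q.1 ∈ I ∧ q.2 ∉ I
      · simp only [h, hq, not_false_eq_true, and_self, if_true]
        exact (hyp.D_continuous q.1 q.2).neg
      · simpa only [h, hq, if_false] using continuous_const
    have hh0 : ∀ q x, 0 ≤ h q x := by
      intro q x
      simp only [h]
      split_ifs with hq
      · exact neg_nonneg.2 (hyp.D_offdiag x _ _ fun e => hq.2 (e ▸ hq.1))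
      · exact le_rfl
    have hper : Periodic fun x => -∑ q, h q x := fun k x => by
      simp only [h, hyp.D_periodic k x]
    obtain ⟨z, hz⟩ := hper.exists_isMax (continuous_finsetSum _ fun q _ => hhc q).neg
    set μ := ∑ q, h q z with hμ
    have hμ0 : 0 < μ := by
      obtain ⟨i, hi, j, hj, hij⟩ := hirr z I hI.1 hI.2
      refine Finset.sum_pos' (fun q _ => hh0 q z) ⟨(i, j), Finset.mem_univ _, ?_⟩
      have h1 : h (i, j) z = -D z i j := by simp [h, hi, hj]
      rw [h1]
      exact neg_pos.2 (lt_of_le_of_ne (hyp.D_offdiag z i j fun e => hj (e ▸ hi)) hij)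
    -- If all pairs leaving `I` fell below this value, the sum would be strictly less than `μ`; the
    -- `+ 1` gives the strictness.
    refine ⟨μ / (m * m + 1), by positivity, fun _ _ x => ?_⟩
    by_contra! hcon
    have h1 : ∑ q, h q x ≤ ∑ _q : Fin m × Fin m, μ / (m * m + 1) := by
      refine Finset.sum_le_sum fun q _ => ?_
      simp only [h]
      split_ifs with hq
      · exact (hcon _ hq.1 _ hq.2).le
      · positivity
    simp only [Finset.sum_const, Finset.card_univ, Fintype.card_prod, Fintype.card_fin,
      nsmul_eq_mul, Nat.cast_mul] at h1
    have h2 : (m * m : ℝ) * (μ / (m * m + 1)) < μ := by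
      rw [← mul_div_assoc, div_lt_iff₀ (by positivity)]
      nlinarith
    linarith [hz x]
  choose δ hδ0 hδ using hone
  obtain ⟨I₀, hI₀⟩ := Finite.exists_min δ
  refine ⟨δ I₀, hδ0 I₀, fun x I h1 h2 => ?_⟩
  obtain ⟨i, hi, j, hj, hij⟩ := hδ I h1 h2 x
  exact ⟨i, hi, j, hj, (hI₀ I).trans hij⟩

/-- A nonnegative vector whose image under an irreducible coupling is bounded from above has
components which differ by a bounded amount, uniformly in `x`. -/
lemma Assumptions.exists_oscillation_le (hyp : Assumptions F f D)
    (hirr : ∀ x, Irreducible (D x)) {A : ℝ} (hA : 0 ≤ A) :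
    ∃ C, 0 ≤ C ∧ ∀ x (a : Fin m → ℝ), (∀ i, 0 ≤ a i) → (∀ i, ∑ j, D x i j * a j ≤ A) →
      ∀ i j, a i - a j ≤ C := by
  classical
  obtain ⟨δ, hδ, hδD⟩ := hyp.exists_irreducible_const hirr
  obtain ⟨d, hd, hdD⟩ := hyp.exists_D_le
  -- The set of indices whose value is within `K` of the maximum is enlarged one index at a time:
  -- irreducibility links some `i` in it to some `j` outside, and row `i` prevents `a j` from being
  -- much smaller.
  have key : ∀ n : ℕ, ∃ K, 0 ≤ K ∧ ∀ x (a : Fin m → ℝ), (∀ i, 0 ≤ a i) →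
      (∀ i, ∑ j, D x i j * a j ≤ A) → ∀ i₀, (∀ k, a k ≤ a i₀) →
      ∃ I : Finset (Fin m), i₀ ∈ I ∧ (n ≤ I.card ∨ I = Finset.univ) ∧
        ∀ i ∈ I, a i₀ ≤ a i + K := by
    intro n
    induction n with
    | zero => exact ⟨0, le_rfl, fun x a _ _ i₀ _ => ⟨{i₀}, by simp, by simp, by simp⟩⟩
    | succ n ih =>
      obtain ⟨K, hK0, hK⟩ := ih
      have hq0 : 0 ≤ (A + d * K) / δ := by positivity
      refine ⟨K + (A + d * K) / δ, by positivity, fun x a ha haD i₀ hi₀ => ?_⟩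
      obtain ⟨I, hI₀, hcard, hI⟩ := hK x a ha haD i₀ hi₀
      by_cases huniv : I = Finset.univ
      · exact ⟨I, hI₀, Or.inr huniv, fun i hi => by linarith [hI i hi]⟩
      obtain ⟨i, hi, j, hj, hij⟩ := hδD x (I : Set (Fin m)) ⟨i₀, hI₀⟩
        (by simpa using huniv)
      have hi : i ∈ I := hi
      have hj : j ∉ I := hj
      refine ⟨insert j I, Finset.mem_insert_of_mem hI₀, Or.inl ?_, fun k hk => ?_⟩
      · rw [Finset.card_insert_of_notMem hj]
        have := hcard.resolve_right huniv
        omega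
      rcases Finset.mem_insert.1 hk with rfl | hk
      swap
      · linarith [hI k hk]
      -- Adding `K` to `a i` makes every difference nonnegative, so a single off-diagonal term is
      -- controlled by the whole row.
      have hik : ∀ k, 0 ≤ a i + K - a k := fun k => by linarith [hI i hi, hi₀ k]
      have h1 : -D x i k * (a i + K - a k) ≤
          ∑ l ∈ Finset.univ.erase i, -D x i l * (a i + K - a l) := by
        refine Finset.single_le_sum (f := fun l => -D x i l * (a i + K - a l))
          (fun l hl => mul_nonneg (neg_nonneg.2 (hyp.D_offdiag x i l
            (Finset.ne_of_mem_erase hl).symm)) (hik l)) ?_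
        exact Finset.mem_erase.2 ⟨fun e => hj (e ▸ hi), Finset.mem_univ _⟩
      have h2 : ∑ l, -D x i l * (a i + K - a l) =
          ∑ l, D x i l * a l - (∑ l, D x i l) * (a i + K) := by
        rw [Finset.sum_mul, ← Finset.sum_sub_distrib]
        exact Finset.sum_congr rfl fun l _ => by ring
      rw [← Finset.add_sum_erase _ _ (Finset.mem_univ i)] at h2
      have h3 : 0 ≤ (∑ l, D x i l) * (a i + K) :=
        mul_nonneg (hyp.D_row x i) (add_nonneg (ha i) hK0)
      have h4 : D x i i * K ≤ d * K :=
        mul_le_mul_of_nonneg_right ((le_abs_self _).trans (hdD x i i)) hK0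
      have h5 : δ * (a i + K - a k) ≤ A + d * K := by
        have := mul_le_mul_of_nonneg_right hij (hik k)
        linarith [haD i]
      have h6 : a i + K - a k ≤ (A + d * K) / δ := by
        rw [le_div_iff₀ hδ]; linarith
      linarith [hI i hi]
  obtain ⟨K, hK0, hK⟩ := key (m + 1)
  refine ⟨K, hK0, fun x a ha haD i j => ?_⟩
  have : Nonempty (Fin m) := ⟨i⟩
  obtain ⟨i₀, hi₀⟩ := Finite.exists_max a
  obtain ⟨I, -, hcard, hI⟩ := hK x a ha haD i₀ hi₀
  have huniv : I = Finset.univ := by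
    refine hcard.resolve_left fun h => ?_
    have := I.card_le_univ
    rw [Fintype.card_fin] at this
    omega
  linarith [hI j (by simp [huniv]), hi₀ i]

/-! ### Discounted systems -/

lemma sum_discount (A : Matrix (Fin m) (Fin m) ℝ) (lam : ℝ) (a : Fin m → ℝ) (i : Fin m) :
    ∑ j, (A + lam • (1 : Matrix (Fin m) (Fin m) ℝ)) i j * a j = ∑ j, A i j * a j + lam * a i := by
  simp [add_mul, Finset.sum_add_distrib, Matrix.one_apply]

lemma Assumptions.discount (hyp : Assumptions F f D) {lam : ℝ} (hlam : 0 ≤ lam) :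
    Assumptions F f fun x => D x + lam • (1 : Matrix (Fin m) (Fin m) ℝ) where
  D_continuous i j := by
    simp only [Matrix.add_apply]
    exact (hyp.D_continuous i j).add continuous_const
  D_periodic := hyp.D_periodic.comp fun A => A + lam • (1 : Matrix (Fin m) (Fin m) ℝ)
  D_diag x i := by
    simpa using add_nonneg (hyp.D_diag x i) hlam
  D_offdiag x i j hij := by
    simpa [Matrix.one_apply, hij] using hyp.D_offdiag x i j hij
  D_row x i := by
    have := sum_discount (D x) lam (fun _ => 1) i
    simp only [mul_one] at this
    rw [this]
    exact add_nonneg (hyp.D_row x i) hlam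
  F_continuous := hyp.F_continuous
  F_periodic := hyp.F_periodic
  F_convex := hyp.F_convex
  F_coercive := hyp.F_coercive
  F_zero := hyp.F_zero
  F_nonneg := hyp.F_nonneg
  f_continuous := hyp.f_continuous
  f_periodic := hyp.f_periodic
  f_nonneg := hyp.f_nonneg

lemma Assumptions.exists_discounted_solution (hyp : Assumptions F f D) {lam : ℝ}
    (hlam : 0 < lam) :
    ∃ v, IsStationarySolution F f (fun x => D x + lam • (1 : Matrix (Fin m) (Fin m) ℝ)) 0 v ∧
      ∀ x i, 0 ≤ v x i := by
  refine (hyp.discount hlam.le).exists_solution_of_pos_row hlam fun x i => ?_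
  have := sum_discount (D x) lam (fun _ => 1) i
  simp only [mul_one] at this
  rw [this]
  linarith [hyp.D_row x i]

lemma IsStationarySolution.exists_abs_le {v : Space N → Fin m → ℝ}
    (hv : IsStationarySolution F f D c v) : ∃ B, 0 ≤ B ∧ ∀ i x, |v x i| ≤ B :=
  exists_common_bound (g := fun i x => v x i) fun i =>
    (hv.periodic.comp fun a => a i).exists_abs_le ((continuous_apply i).comp hv.continuous)

/-- As the Hamiltonians are nonnegative, the coupling term of a subsolution is bounded from above
at every point. -/
lemma IsStationarySolution.coupling_le (hyp : Assumptions F f D) {v : Space N → Fin m → ℝ}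
    (hv : IsStationarySolution F f D c v) (x : Space N) (i : Fin m) :
    ∑ j, D x i j * v x j ≤ f i x + c i := by
  obtain ⟨B, -, hB⟩ := hv.exists_abs_le
  have hvc : ∀ j, Continuous fun x => v x j := fun j => (continuous_apply j).comp hv.continuous
  have hc : Continuous fun x => f i x + c i - ∑ j, D x i j * v x j :=
    ((hyp.f_continuous i).add continuous_const).sub (hyp.continuous_coupling continuous_id hvc i)
  by_contra! hlt
  -- There may be no test function at `x` itself, but the strict inequality is open and points
  -- touched from above are dense.
  obtain ⟨ψ, y, hy, hψ, hmax⟩ := exists_isLocalMax_near (hvc i) (hB i) x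
    (hc.continuousAt.eventually_lt_const (sub_neg.2 hlt))
  have h1 := hv.sub i ψ hψ y hmax
  have h2 := hyp.F_nonneg i y (gradient ψ y)
  have hy : f i y + c i - ∑ j, D y i j * v y j < 0 := hy
  linarith

/-- Estimates for the discounted systems which are uniform in the discount factor. -/
lemma Assumptions.exists_uniform_estimate (hyp : Assumptions F f D)
    (hirr : ∀ x, Irreducible (D x)) :
    ∃ (R : NNReal) (C A : ℝ), ∀ (lam : ℝ) (v : Space N → Fin m → ℝ), 0 < lam →
      IsStationarySolution F f (fun x => D x + lam • (1 : Matrix (Fin m) (Fin m) ℝ)) 0 v →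
      (∀ x i, 0 ≤ v x i) →
      (∀ i, LipschitzWith R fun x => v x i) ∧ (∀ x i j, |v x i - v x j| ≤ C) ∧
        ∀ x i, lam * v x i ≤ A := by
  obtain ⟨A, hA0, hA⟩ := hyp.exists_f_le
  obtain ⟨C, hC0, hC⟩ := hyp.exists_oscillation_le hirr hA0
  obtain ⟨A', hA'0, hA'⟩ := hyp.exists_abs_coupling_le
  obtain ⟨R, hR⟩ := hyp.exists_norm_le (A + A' * C)
  refine ⟨R, C, A, fun lam v hlam hv h0 => ?_⟩
  have hpt : ∀ x i, ∑ j, D x i j * v x j + lam * v x i ≤ f i x := fun x i => by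
    have := hv.coupling_le (hyp.discount hlam.le) x i
    rw [sum_discount] at this
    simpa using this
  have hle : ∀ x i j, v x i - v x j ≤ C := fun x => hC x (v x) (h0 x) fun i => by
    linarith [hpt x i, hA i x, mul_nonneg hlam.le (h0 x i)]
  have hosc : ∀ x i j, |v x i - v x j| ≤ C := fun x i j =>
    abs_sub_le_iff.2 ⟨hle x i j, hle x j i⟩
  refine ⟨fun i => ?_, hosc, fun x i => ?_⟩
  · obtain ⟨B, -, hB⟩ := hv.exists_abs_le
    refine hv.sub.lipschitzWith hv.continuous (fun x i => hB i x) (fun x => ?_) hR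
    rw [sum_discount]
    -- Writing `D v` as `D (v - v i)` plus the row sum times `v i`, the first term is bounded by the
    -- oscillation and the second is nonnegative. Only a lower bound is needed, so the size of `v`
    -- does not enter.
    have h1 := coupling_add_const (D x) (fun j => v x j - v x i) (v x i) i
    simp only [sub_add_cancel] at h1
    have h2 := (abs_le.1 (hA' x i (fun j => v x j - v x i) C fun j => hosc x j i)).1
    have h3 := mul_nonneg (hyp.D_row x i) (h0 x i)
    simp only [Pi.zero_apply]
    linarith [hA i x, mul_nonneg hlam.le (h0 x i)]
  · have : Nonempty (Fin m) := ⟨i⟩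
    obtain ⟨i₀, hi₀⟩ := Finite.exists_max (v x)
    have h1 := hyp.coupling_nonneg x hi₀ (h0 x i₀)
    have h2 := mul_le_mul_of_nonneg_left (hi₀ i) hlam.le
    linarith [hpt x i₀, hA i₀ x]

/-- The discounted solutions stay at bounded distance from a constant which the coupling does not
see; it may be taken to be `0` if the `f_i` have a common zero. -/
lemma Assumptions.exists_normalization (hyp : Assumptions F f D)
    (hcase : CommonZeroCase f D ∨ ConstantCouplingCase D) :
    ∃ (R : NNReal) (C A : ℝ), ∀ (lam : ℝ) (v : Space N → Fin m → ℝ), 0 < lam →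
      IsStationarySolution F f (fun x => D x + lam • (1 : Matrix (Fin m) (Fin m) ℝ)) 0 v →
      (∀ x i, 0 ≤ v x i) →
      (∀ i, LipschitzWith R fun x => v x i) ∧ ∃ κ, (∀ x i, |v x i - κ| ≤ C) ∧
        (∀ x i, (∑ j, D x i j) * κ = 0) ∧ |lam * κ| ≤ A ∧ (CommonZeroCase f D → κ = 0) := by
  have hirr : ∀ x, Irreducible (D x) := hcase.elim (fun h => h.1) fun h => h.2.2
  obtain ⟨R, C, A, hest⟩ := hyp.exists_uniform_estimate hirr
  obtain ⟨Q, hQ, hk⟩ := exists_isCompact_translate N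
  -- a base point, a common zero if there is one
  obtain ⟨x₀, hx₀⟩ : ∃ x₀ : Space N, CommonZeroCase f D → ∀ i, f i x₀ = 0 := by
    by_cases h : CommonZeroCase f D
    · obtain ⟨x₀, hx₀⟩ := h.2
      refine ⟨x₀, fun _ i => ?_⟩
      exact (Finset.sum_eq_zero_iff_of_nonneg fun i _ => hyp.f_nonneg i x₀).1 hx₀ i
        (Finset.mem_univ i)
    · exact ⟨0, fun h' => absurd h' h⟩
  obtain ⟨d, hd⟩ := hQ.isBounded.subset_closedBall x₀
  -- The distance to the base point costs `R * d` and a change of component costs `C`. The maximum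
  -- with `0` covers the choice `κ = 0`, as no sign of `A` is recorded.
  refine ⟨R, R * d + C, max A 0, fun lam v hlam hv h0 => ?_⟩
  obtain ⟨hlip, hosc, hA⟩ := hest lam v hlam hv h0
  refine ⟨hlip, ?_⟩
  have hdist : ∀ x i j, |v x i - v x₀ j| ≤ R * d + C := by
    intro x i j
    obtain ⟨k, hkx⟩ := hk x
    have h1 := (hlip i).dist_le_mul (x + intVec k) x₀
    rw [show v (x + intVec k) = v x from hv.periodic k x, Real.dist_eq] at h1
    have h2 : (R : ℝ) * dist (x + intVec k) x₀ ≤ R * d :=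
      mul_le_mul_of_nonneg_left (hd hkx) R.2
    linarith [hosc x₀ i j, abs_sub_le (v x i) (v x₀ i) (v x₀ j)]
  -- At a common zero the largest component has nonnegative coupling, hence `lam * v ≤ 0` there.
  have hzero : CommonZeroCase f D → ∀ i, v x₀ i = 0 := by
    intro h i
    have : Nonempty (Fin m) := ⟨i⟩
    obtain ⟨i₀, hi₀⟩ := Finite.exists_max (v x₀)
    have h1 := hyp.coupling_nonneg x₀ hi₀ (h0 x₀ i₀)
    have h2 := hv.coupling_le (hyp.discount hlam.le) x₀ i₀
    rw [sum_discount, hx₀ h, Pi.zero_apply, add_zero] at h2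
    have h3 : v x₀ i₀ ≤ 0 := by
      by_contra! hlt
      linarith [mul_pos hlam hlt]
    exact le_antisymm ((hi₀ i).trans h3) (h0 x₀ i)
  by_cases h : CommonZeroCase f D
  · refine ⟨0, fun x i => ?_, by simp, by simp, fun _ => rfl⟩
    have := hdist x i i
    rwa [hzero h i] at this
  · have hrow := (hcase.resolve_left h).2.1
    rcases isEmpty_or_nonempty (Fin m) with he | ⟨⟨i₀⟩⟩
    · exact ⟨0, fun x i => he.elim i, fun x i => he.elim i, by simp, fun _ => rfl⟩
    · refine ⟨v x₀ i₀, fun x i => hdist x i i₀, fun x i => by rw [hrow, zero_mul], ?_,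
        fun h' => absurd h' h⟩
      rw [abs_of_nonneg (mul_nonneg hlam.le (h0 x₀ i₀))]
      exact (hA x₀ i₀).trans (le_max_left _ _)

/-- Existence of an ergodic constant, by vanishing discount. -/
theorem Assumptions.exists_isErgodicConstant (hyp : Assumptions F f D)
    (hcase : CommonZeroCase f D ∨ ConstantCouplingCase D) :
    ∃ c, IsErgodicConstant F f D c ∧ (CommonZeroCase f D → c = 0) := by
  obtain ⟨R, C, A, hnorm⟩ := hyp.exists_normalization hcase
  let lam : ℕ → ℝ := fun n => 1 / ((n : ℝ) + 1)
  have hlam : ∀ n, 0 < lam n := fun n => by positivity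
  choose v hv h0 using fun n => hyp.exists_discounted_solution (hlam n)
  choose hlip κ hκ hrow hA hκ0 using fun n => hnorm (lam n) (v n) (hlam n) (hv n) (h0 n)
  let l : Ultrafilter ℕ := hyperfilter ℕ
  have hl : (l : Filter ℕ) ≤ atTop := by
    rw [← Nat.cofinite_eq_atTop]; exact hyperfilter_le_cofinite
  have hlam0 : Tendsto lam l (𝓝 0) := tendsto_one_div_add_atTop_nhds_zero_nat.mono_left hl
  obtain ⟨μ, -, hμ⟩ := exists_tendsto_of_eventually_mem (isCompact_Icc (a := -A) (b := A)) l
    (y := fun n => lam n * κ n) (Eventually.of_forall fun n => abs_le.1 (hA n))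
  have hex : ∀ x i, ∃ a, Tendsto (fun n => v n x i - κ n) l (𝓝 a) := fun x i => by
    obtain ⟨a, -, ha⟩ := exists_tendsto_of_eventually_mem (isCompact_Icc (a := -C) (b := C)) l
      (y := fun n => v n x i - κ n) (Eventually.of_forall fun n => abs_le.1 (hκ n x i))
    exact ⟨a, ha⟩
  choose w hw using hex
  have hlip' : ∀ i n, LipschitzWith R fun x => v n x i - κ n := fun i n =>
    LipschitzWith.of_dist_le_mul fun x y => by simpa using (hlip n i).dist_le_mul x y
  have hwlip : ∀ i, LipschitzWith R fun x => w x i := fun i =>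
    LipschitzWith.of_dist_le_mul fun x y =>
      le_of_tendsto ((hw x i).dist (hw y i)) (Eventually.of_forall fun n =>
        (hlip' i n).dist_le_mul x y)
  have hwcont : Continuous w := continuous_pi fun i => (hwlip i).continuous
  have hwper : Periodic w := fun k x => by
    ext i
    refine tendsto_nhds_unique (hw (x + intVec k) i) ((hw x i).congr fun n => ?_)
    rw [show v n (x + intVec k) = v n x from (hv n).periodic k x]
  -- the discounted coupling in terms of the normalized functions
  have hcoup : ∀ n x i, ∑ j, (D x + lam n • (1 : Matrix (Fin m) (Fin m) ℝ)) i j * v n x j =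
      ∑ j, D x i j * (v n x j - κ n) + (lam n * (v n x i - κ n) + lam n * κ n) := by
    intro n x i
    rw [sum_discount]
    have := coupling_add_const (D x) (fun j => v n x j - κ n) (κ n) i
    simp only [sub_add_cancel] at this
    rw [this, hrow n x i]
    ring
  have hlimit : ∀ {i x} {y p : ℕ → Space N} {p₀ : Space N}, Tendsto y l (𝓝 x) →
      Tendsto p l (𝓝 p₀) →
      Tendsto (fun n => F i (y n) (p n) - f i (y n) +
        ∑ j, (D (y n) + lam n • (1 : Matrix (Fin m) (Fin m) ℝ)) i j * v n (y n) j) l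
        (𝓝 (F i x p₀ - f i x + (∑ j, D x i j * w x j + μ))) := by
    intro i x y p p₀ hy hp
    simp only [hcoup]
    have h1 : ∀ j, Tendsto (fun n => v n (y n) j - κ n) l (𝓝 (w x j)) := fun j =>
      tendsto_apply_of_equilipschitz (w := fun n x => v n x j - κ n) (hlip' j) (hw x j) hy
    have h2 := (hlam0.mul (h1 i)).add hμ
    rw [zero_mul, zero_add] at h2
    exact ((hyp.tendsto_F hy hp i).sub (((hyp.f_continuous i).tendsto x).comp hy)).add
      ((hyp.tendsto_coupling hy h1 i).add h2)
  -- The limit `μ` of `lam n * κ n` remains on the left of the limiting equation; moved to the right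
  -- it becomes `c = -μ` in every component.
  refine ⟨fun _ => -μ, ⟨fun x i => ?_, w, hwcont, hwper, ?_, ?_⟩, fun h => ?_⟩
  · rw [← Finset.sum_mul]
    have h1 := hμ.const_mul (∑ j, D x i j)
    have h2 : (fun n => (∑ j, D x i j) * (lam n * κ n)) = fun _ => 0 := by
      ext n
      rw [mul_left_comm, hrow, mul_zero]
    rw [h2] at h1
    have := tendsto_nhds_unique h1 tendsto_const_nhds
    linarith
  · intro i φ hφ x hmax
    obtain ⟨ψ, y, hψ, hy, hymax, hgrad, -⟩ := exists_tendsto_isLocalMax l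
      (w := fun n z => v n z i - κ n) (v := fun z => w z i) (hlip' i) hφ hmax (hw x i)
      fun z ε hε => (hw z i).eventually_le_const (lt_add_of_pos_right _ hε)
    have h1 := le_of_tendsto (hlimit (i := i) hy hgrad) (b := 0) (by
      filter_upwards [hymax] with n hn
      refine (hv n).sub i ψ hψ (y n) ?_
      filter_upwards [hn] with z hz
      linarith)
    linarith
  · intro i φ hφ x hmin
    -- Touching from below is touching from above for the negated functions.
    obtain ⟨ψ, y, hψ, hy, hymax, hgrad, -⟩ := exists_tendsto_isLocalMax l
      (w := fun n z => -(v n z i - κ n)) (v := fun z => -w z i) (φ := fun z => -φ z)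
      (fun n => (hlip' i n).neg) hφ.neg
      (by filter_upwards [hmin] with z hz; linarith) (hw x i).neg
      fun z ε hε => (hw z i).neg.eventually_le_const (lt_add_of_pos_right _ hε)
    have hgrad' : Tendsto (fun n => gradient (fun z => -ψ z) (y n)) l (𝓝 (gradient φ x)) := by
      simp only [gradient_neg] at hgrad ⊢
      simpa using hgrad.neg
    have h1 := ge_of_tendsto (hlimit (i := i) hy hgrad') (b := 0) (by
      filter_upwards [hymax] with n hn
      refine (hv n).super i (fun z => -ψ z) hψ.neg (y n) ?_
      filter_upwards [hn] with z hz
      linarith)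
    linarith
  · have h1 : Tendsto (fun n => lam n * κ n) l (𝓝 0) := by
      simp only [hκ0 _ h, mul_zero]
      exact tendsto_const_nhds
    ext
    simp [tendsto_nhds_unique hμ h1]

end ErgodicProblem

/-! ### Uniqueness of the ergodic constant and large-time estimates -/

section EvolutionEstimates

variable {N m : ℕ} {F : Fin m → Space N → Space N → ℝ} {f : Fin m → Space N → ℝ}
  {D : Space N → Matrix (Fin m) (Fin m) ℝ} {c : Fin m → ℝ}

/-! ### Functions which are affine in time -/

/-- Smoothness in time forces the time derivative of a test function, so testing a function affine
in time reduces to testing its spatial part. -/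
lemma isLocalMax_slices {a : Space N → ℝ} {e : ℝ} {φ : Space N × ℝ → ℝ} (hφ : ContDiff ℝ 1 φ)
    {x : Space N} {t : ℝ} (h : IsLocalMax (fun q : Space N × ℝ => a q.1 + e * q.2 - φ q) (x, t)) :
    IsLocalMax (fun y => a y - φ (y, t)) x ∧ deriv (fun s => φ (x, s)) t = e := by
  constructor
  · have h1 : Tendsto (fun y : Space N => (y, t)) (𝓝 x) (𝓝 (x, t)) :=
      (Continuous.prodMk_left t).tendsto x
    filter_upwards [h1.eventually h] with y hy
    linarith
  · have h1 : Tendsto (fun s : ℝ => (x, s)) (𝓝 t) (𝓝 (x, t)) :=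
      (Continuous.prodMk_right x).tendsto t
    have h2 : IsLocalMax (fun s => e * s - φ (x, s)) t := by
      filter_upwards [h1.eventually h] with s hs
      linarith
    have hd : DifferentiableAt ℝ (fun s => φ (x, s)) t :=
      ((hφ.comp (contDiff_prodMk_right x)).differentiable (by norm_num)) t
    have h3 := h2.deriv_eq_zero
    rw [deriv_fun_sub (by fun_prop) hd, deriv_const_mul_field] at h3
    simp only [deriv_id'', mul_one] at h3
    linarith

lemma isEvolutionSubsolution_of_affine {a : Space N → Fin m → ℝ} {e : Fin m → ℝ}
    (h : ∀ i (φ : Space N → ℝ), ContDiff ℝ 1 φ → ∀ x t, 0 < t →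
      IsLocalMax (fun y => a y i - φ y) x →
      e i + (F i x (gradient φ x) - f i x) + ∑ j, D x i j * (a x j + e j * t) ≤ 0) :
    IsEvolutionSubsolution F f D fun x t i => a x i + e i * t := by
  intro i φ hφ x t ht hmax
  obtain ⟨h1, h2⟩ := isLocalMax_slices (a := fun y => a y i) hφ hmax
  rw [h2]
  exact h i _ (hφ.comp (contDiff_prodMk_left t)) x t ht h1

lemma isEvolutionSupersolution_of_affine {a : Space N → Fin m → ℝ} {e : Fin m → ℝ}
    (h : ∀ i (φ : Space N → ℝ), ContDiff ℝ 1 φ → ∀ x t, 0 < t →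
      IsLocalMin (fun y => a y i - φ y) x →
      0 ≤ e i + (F i x (gradient φ x) - f i x) + ∑ j, D x i j * (a x j + e j * t)) :
    IsEvolutionSupersolution F f D fun x t i => a x i + e i * t := by
  intro i φ hφ x t ht hmin
  obtain ⟨h1, h2⟩ := isLocalMax_slices (a := fun y => -a y i) (e := -e i) (φ := fun q => -φ q)
    hφ.neg (x := x) (t := t) (by filter_upwards [hmin] with q hq; linarith)
  rw [deriv.fun_neg, neg_inj] at h2
  rw [h2]
  refine h i _ (hφ.comp (contDiff_prodMk_left t)) x t ht ?_
  filter_upwards [h1] with y hy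
  simp only [Function.comp_apply]
  linarith

lemma continuousOn_affine {a : Space N → Fin m → ℝ} (ha : Continuous a) (e : Fin m → ℝ)
    (s : Set (Space N × ℝ)) :
    ContinuousOn (fun q : Space N × ℝ => fun i => a q.1 i + e i * q.2) s := by
  refine Continuous.continuousOn (continuous_pi fun i => ?_)
  have : Continuous fun q : Space N × ℝ => a q.1 i :=
    ((continuous_apply i).comp ha).comp continuous_fst
  fun_prop

lemma Periodic.affine {a : Space N → Fin m → ℝ} (ha : Periodic a) (e : Fin m → ℝ) (t : ℝ) :
    Periodic fun x i => a x i + e i * t :=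
  ha.comp fun b i => b i + e i * t

/-- The coupling term along a stationary solution moving in a direction of the kernel. -/
lemma coupling_stationary {x : Space N} {i : Fin m} (hc : ∑ j, D x i j * c j = 0)
    (v : Fin m → ℝ) (b t : ℝ) :
    ∑ j, D x i j * (v j + b + -c j * t) = ∑ j, D x i j * v j + (∑ j, D x i j) * b := by
  have h : ∑ j, D x i j * (v j + b + -c j * t) =
      ∑ j, D x i j * (v j + b) - (∑ j, D x i j * c j) * t := by
    rw [Finset.sum_mul, ← Finset.sum_sub_distrib]
    exact Finset.sum_congr rfl fun j _ => by ring
  rw [h, hc, coupling_add_const]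
  ring

/-- The drift `-c t` is invisible to the coupling since `D c = 0`, and lowering all components by
the same constant is harmless because row sums are nonnegative. -/
lemma Assumptions.stationary_isEvolutionSubsolution (hyp : Assumptions F f D)
    (hc : ∀ x i, ∑ j, D x i j * c j = 0) {v : Space N → Fin m → ℝ}
    (hv : IsStationarySubsolution F f D c v) {b : ℝ} (hb : b ≤ 0) :
    IsEvolutionSubsolution F f D fun x t i => (v x i + b) + -c i * t := by
  refine isEvolutionSubsolution_of_affine (a := fun x i => v x i + b) (e := fun i => -c i) ?_
  intro i φ hφ x t ht hmax
  have h1 := hv i φ hφ x (by filter_upwards [hmax] with y hy; linarith)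
  rw [coupling_stationary (hc x i)]
  linarith [mul_nonpos_of_nonneg_of_nonpos (hyp.D_row x i) hb]

lemma Assumptions.stationary_isEvolutionSupersolution (hyp : Assumptions F f D)
    (hc : ∀ x i, ∑ j, D x i j * c j = 0) {v : Space N → Fin m → ℝ}
    (hv : IsStationarySupersolution F f D c v) {b : ℝ} (hb : 0 ≤ b) :
    IsEvolutionSupersolution F f D fun x t i => (v x i + b) + -c i * t := by
  refine isEvolutionSupersolution_of_affine (a := fun x i => v x i + b) (e := fun i => -c i) ?_
  intro i φ hφ x t ht hmin
  have h1 := hv i φ hφ x (by filter_upwards [hmin] with y hy; linarith)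
  rw [coupling_stationary (hc x i)]
  linarith [mul_nonneg (hyp.D_row x i) hb]

/-! ### Uniqueness of the ergodic constant -/

/-- Comparison orders `v - c t`, shifted down, below `v' - c' t` for all times. The stationary parts
are bounded, so `(c' i - c i) * t` is bounded above as `t` grows. -/
lemma Assumptions.ergodicConstant_le (hyp : Assumptions F f D) {c' : Fin m → ℝ}
    (h : IsErgodicConstant F f D c) (h' : IsErgodicConstant F f D c') (i : Fin m) :
    c' i ≤ c i := by
  obtain ⟨hc, v, hv⟩ := h
  obtain ⟨hc', v', hv'⟩ := h'
  obtain ⟨B, hB0, hB⟩ := hv.exists_abs_le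
  obtain ⟨B', hB'0, hB'⟩ := hv'.exists_abs_le
  have key : ∀ t, 0 ≤ t → (c' i - c i) * t ≤ 2 * (B + B') := by
    intro t ht
    have hper : ∀ {v : Space N → Fin m → ℝ}, Periodic v → ∀ b : ℝ, Periodic fun x i => v x i + b :=
      fun hv b => hv.comp fun a i => a i + b
    have hcon : ∀ {v : Space N → Fin m → ℝ}, Continuous v → ∀ b : ℝ,
        Continuous fun x i => v x i + b := fun hv b =>
      continuous_pi fun i => ((continuous_apply i).comp hv).add continuous_const
    have h1 := hyp.comparison
      (continuousOn_affine (hcon hv.continuous (-(B + B'))) (fun i => -c i) _)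
      (fun t _ => (hper hv.periodic _).affine (fun i => -c i) t)
      (hyp.stationary_isEvolutionSubsolution hc hv.sub (b := -(B + B')) (by linarith))
      (continuousOn_affine (hcon hv'.continuous 0) (fun i => -c' i) _)
      (fun t _ => (hper hv'.periodic _).affine (fun i => -c' i) t)
      (hyp.stationary_isEvolutionSupersolution hc' hv'.super (b := 0) le_rfl)
      (fun x i => by
        simp only [mul_zero, add_zero]
        linarith [(abs_le.1 (hB i x)).2, (abs_le.1 (hB' i x)).1]) (x := 0) ht i
    linarith [(abs_le.1 (hB i 0)).1, (abs_le.1 (hB' i 0)).2]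
  by_contra! hlt
  have hpos := sub_pos.2 hlt
  have h1 := key ((2 * (B + B') + 1) / (c' i - c i)) (by positivity)
  rw [mul_div_cancel₀ _ hpos.ne'] at h1
  linarith

/-! ### Operations on sub- and supersolutions -/

lemma IsEvolutionSubsolution.shift {u : Space N → ℝ → Fin m → ℝ}
    (hu : IsEvolutionSubsolution F f D u) {h : ℝ} (hh : 0 ≤ h) :
    IsEvolutionSubsolution F f D fun x t => u x (t + h) := by
  intro i φ hφ x t ht hmax
  have h1 := hu i (fun q => φ (q.1, q.2 - h)) (hφ.comp (by fun_prop)) x (t + h) (by linarith) (by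
    have h2 : Tendsto (fun q : Space N × ℝ => (q.1, q.2 - h)) (𝓝 (x, t + h)) (𝓝 (x, t)) := by
      have : Continuous fun q : Space N × ℝ => (q.1, q.2 - h) := by fun_prop
      simpa using this.tendsto (x, t + h)
    filter_upwards [h2.eventually hmax] with q hq
    simpa using hq)
  have h3 : deriv (fun s => φ (x, s - h)) (t + h) = deriv (fun s => φ (x, s)) t := by
    rw [deriv_comp_sub_const (fun s => φ (x, s)), add_sub_cancel_right]
  simp only [h3, add_sub_cancel_right] at h1
  exact h1

lemma IsEvolutionSupersolution.shift {u : Space N → ℝ → Fin m → ℝ}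
    (hu : IsEvolutionSupersolution F f D u) {h : ℝ} (hh : 0 ≤ h) :
    IsEvolutionSupersolution F f D fun x t => u x (t + h) := by
  intro i φ hφ x t ht hmin
  have h1 := hu i (fun q => φ (q.1, q.2 - h)) (hφ.comp (by fun_prop)) x (t + h) (by linarith) (by
    have h2 : Tendsto (fun q : Space N × ℝ => (q.1, q.2 - h)) (𝓝 (x, t + h)) (𝓝 (x, t)) := by
      have : Continuous fun q : Space N × ℝ => (q.1, q.2 - h) := by fun_prop
      simpa using this.tendsto (x, t + h)
    filter_upwards [h2.eventually hmin] with q hq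
    simpa using hq)
  have h3 : deriv (fun s => φ (x, s - h)) (t + h) = deriv (fun s => φ (x, s)) t := by
    rw [deriv_comp_sub_const (fun s => φ (x, s)), add_sub_cancel_right]
  simp only [h3, add_sub_cancel_right] at h1
  exact h1

lemma IsEvolutionSubsolution.add_const (hyp : Assumptions F f D) {u : Space N → ℝ → Fin m → ℝ}
    (hu : IsEvolutionSubsolution F f D u) {b : ℝ} (hb : b ≤ 0) :
    IsEvolutionSubsolution F f D fun x t i => u x t i + b := by
  intro i φ hφ x t ht hmax
  have h1 := hu i φ hφ x t ht (by filter_upwards [hmax] with q hq; linarith)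
  rw [coupling_add_const]
  linarith [mul_nonpos_of_nonneg_of_nonpos (hyp.D_row x i) hb]

lemma IsEvolutionSupersolution.add_const (hyp : Assumptions F f D) {u : Space N → ℝ → Fin m → ℝ}
    (hu : IsEvolutionSupersolution F f D u) {b : ℝ} (hb : 0 ≤ b) :
    IsEvolutionSupersolution F f D fun x t i => u x t i + b := by
  intro i φ hφ x t ht hmin
  have h1 := hu i φ hφ x t ht (by filter_upwards [hmin] with q hq; linarith)
  rw [coupling_add_const]
  linarith [mul_nonneg (hyp.D_row x i) hb]

/-! ### Estimates for solutions of the evolution system -/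

variable {u₀ : Space N → Fin m → ℝ}

lemma exists_abs_initial_le (hper : Periodic u₀) (hcont : Continuous u₀) :
    ∃ B, 0 ≤ B ∧ ∀ i x, |u₀ x i| ≤ B :=
  exists_common_bound (g := fun i x => u₀ x i) fun i =>
    (hper.comp fun a => a i).exists_abs_le ((continuous_apply i).comp hcont)

/-- Comparison with a stationary solution. -/
lemma Assumptions.exists_abs_add_le (hyp : Assumptions F f D) (h : IsErgodicConstant F f D c)
    (hper : Periodic u₀) (hcont : Continuous u₀) :
    ∃ C, 0 ≤ C ∧ ∀ u, IsEvolutionSolution F f D u₀ u →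
      ∀ x t, 0 ≤ t → ∀ i, |u x t i + c i * t| ≤ C := by
  obtain ⟨hc, v, hv⟩ := h
  obtain ⟨B, hB0, hB⟩ := hv.exists_abs_le
  obtain ⟨B', hB'0, hB'⟩ := exists_abs_initial_le hper hcont
  refine ⟨2 * B + B', by positivity, fun u hu x t ht i => ?_⟩
  have hper' : ∀ b : ℝ, Periodic fun x i => v x i + b := fun b => hv.periodic.comp fun a i => a i + b
  have hcon : ∀ b : ℝ, Continuous fun x i => v x i + b := fun b =>
    continuous_pi fun i => ((continuous_apply i).comp hv.continuous).add continuous_const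
  have h1 := hyp.comparison hu.continuousOn hu.periodic hu.sub
    (continuousOn_affine (hcon (B + B')) (fun i => -c i) _)
    (fun t _ => (hper' _).affine (fun i => -c i) t)
    (hyp.stationary_isEvolutionSupersolution hc hv.super (b := B + B') (by positivity))
    (fun x i => by
      rw [hu.initial]
      linarith [(abs_le.1 (hB i x)).1, (abs_le.1 (hB' i x)).2]) (x := x) ht i
  have h2 := hyp.comparison (continuousOn_affine (hcon (-(B + B'))) (fun i => -c i) _)
    (fun t _ => (hper' _).affine (fun i => -c i) t)
    (hyp.stationary_isEvolutionSubsolution hc hv.sub (b := -(B + B')) (by linarith))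
    hu.continuousOn hu.periodic hu.super
    (fun x i => by
      rw [hu.initial]
      linarith [(abs_le.1 (hB i x)).2, (abs_le.1 (hB' i x)).1]) (x := x) ht i
  rw [abs_le]
  constructor <;> linarith [(abs_le.1 (hB i x)).1, (abs_le.1 (hB i x)).2]

lemma Assumptions.exists_F_le (hyp : Assumptions F f D) (K : ℝ) :
    ∃ A, 0 ≤ A ∧ ∀ i x p, ‖p‖ ≤ K → F i x p ≤ A := by
  obtain ⟨Q, hQ, hk⟩ := exists_isCompact_translate N
  have hS : IsCompact (Q ×ˢ Metric.closedBall (0 : Space N) K) :=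
    hQ.prod (isCompact_closedBall 0 K)
  obtain ⟨A, hA0, hA⟩ := exists_common_bound (ι := Fin m)
    (g := fun i (q : ↥(Q ×ˢ Metric.closedBall (0 : Space N) K)) => F i q.1.1 q.1.2) fun i => by
      obtain ⟨A, hA⟩ := hS.exists_bound_of_continuousOn (hyp.F_continuous i).continuousOn
      exact ⟨A, fun q => hA q.1 q.2⟩
  refine ⟨A, hA0, fun i x p hp => ?_⟩
  obtain ⟨k, hkx⟩ := hk x
  have h1 := hA i ⟨(x + intVec k, p), hkx, by simpa using hp⟩
  rw [show F i (x + intVec k) p = F i x p from hyp.F_periodic i p k x] at h1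
  exact (le_abs_self _).trans h1

/-- Lipschitz continuity in time at the initial time, by barriers. -/
lemma Assumptions.exists_abs_sub_initial_le (hyp : Assumptions F f D) (hper : Periodic u₀)
    {K : NNReal} (hK : LipschitzWith K u₀) :
    ∃ K₁, 0 ≤ K₁ ∧ ∀ u, IsEvolutionSolution F f D u₀ u →
      ∀ x t, 0 ≤ t → ∀ i, |u x t i - u₀ x i| ≤ K₁ * t := by
  have hcont := hK.continuous
  obtain ⟨B, hB0, hB⟩ := exists_abs_initial_le hper hcont
  obtain ⟨A, hA0, hA⟩ := hyp.exists_F_le K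
  obtain ⟨A₁, hA₁0, hA₁⟩ := hyp.exists_f_le
  obtain ⟨A₂, hA₂0, hA₂⟩ := hyp.exists_abs_coupling_le
  have hgrad : ∀ i (φ : Space N → ℝ), ContDiff ℝ 1 φ → ∀ x,
      IsLocalMax (fun y => u₀ y i - φ y) x → ‖gradient φ x‖ ≤ K := fun i φ hφ x hmax =>
    norm_gradient_le_of_isLocalMax_sub
      (w := fun y => u₀ y i) (LipschitzWith.of_dist_le_mul fun y z =>
        (dist_le_pi_dist (u₀ y) (u₀ z) i).trans (hK.dist_le_mul y z))
      (hφ.differentiable (by norm_num) x) hmax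
  -- Large enough for `u₀ + K₁ t` and `u₀ - K₁ t` to be barriers: `A` bounds `F` at gradients
  -- touching the Lipschitz function `u₀`, `A₁` bounds `f` and `A₂ * B` the coupling of `u₀`.
  set K₁ := A + A₁ + A₂ * B
  have hK₁ : 0 ≤ K₁ := by positivity
  have hD : ∀ x i, |∑ j, D x i j * u₀ x j| ≤ A₂ * B := fun x i =>
    hA₂ x i (u₀ x) B fun j => hB j x
  refine ⟨K₁, hK₁, fun u hu x t ht i => ?_⟩
  have h1 := hyp.comparison hu.continuousOn hu.periodic hu.sub
    (continuousOn_affine hcont (fun _ => K₁) _) (fun t _ => hper.affine (fun _ => K₁) t)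
    (isEvolutionSupersolution_of_affine fun i φ hφ x t ht hmin => by
      rw [coupling_add_const]
      linarith [hA₁ i x, hyp.F_nonneg i x (gradient φ x), (abs_le.1 (hD x i)).1,
        mul_nonneg (hyp.D_row x i) (mul_nonneg hK₁ ht.le)])
    (fun x i => by simp [hu.initial]) (x := x) ht i
  have h2 := hyp.comparison
    (continuousOn_affine hcont (fun _ => -K₁) _) (fun t _ => hper.affine (fun _ => -K₁) t)
    (isEvolutionSubsolution_of_affine fun i φ hφ x t ht hmax => by
      rw [coupling_add_const]
      linarith [hyp.f_nonneg i x, hA i x _ (hgrad i φ hφ x hmax), (abs_le.1 (hD x i)).2,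
        mul_nonneg (hyp.D_row x i) (mul_nonneg hK₁ ht.le)])
    hu.continuousOn hu.periodic hu.super
    (fun x i => by simp [hu.initial]) (x := x) ht i
  rw [abs_le]
  constructor <;> linarith

/-- Lipschitz continuity in time. -/
lemma IsEvolutionSolution.abs_sub_time_le (hyp : Assumptions F f D)
    {u : Space N → ℝ → Fin m → ℝ} (hu : IsEvolutionSolution F f D u₀ u) {K₁ : ℝ} (hK₁ : 0 ≤ K₁)
    (h0 : ∀ x t, 0 ≤ t → ∀ i, |u x t i - u₀ x i| ≤ K₁ * t) (x : Space N) {t s : ℝ} (ht : 0 ≤ t)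
    (hs : 0 ≤ s) (i : Fin m) : |u x t i - u x s i| ≤ K₁ * |t - s| := by
  -- The system is autonomous, so `u` shifted by `h` is compared with `u ± K₁ * h`, the ordering at
  -- time `0` being the initial estimate.
  have key : ∀ t h, 0 ≤ t → 0 ≤ h → |u x (t + h) i - u x t i| ≤ K₁ * h := by
    intro t h ht hh
    have hcont : ContinuousOn (fun q : Space N × ℝ => u q.1 (q.2 + h)) (univ ×ˢ Ici 0) :=
      hu.continuousOn.comp (f := fun q : Space N × ℝ => (q.1, q.2 + h))
        (by fun_prop) fun q hq => ⟨mem_univ _, add_nonneg hq.2 hh⟩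
    have hcont' : ∀ b : ℝ,
        ContinuousOn (fun q : Space N × ℝ => fun i => u q.1 q.2 i + b) (univ ×ˢ Ici 0) := fun b =>
      continuousOn_pi.2 fun i => ((continuous_apply i).comp_continuousOn hu.continuousOn).add
        continuousOn_const
    have hper : ∀ b t, 0 ≤ t → Periodic fun x i => u x t i + b := fun b t ht =>
      (hu.periodic t ht).comp fun a i => a i + b
    have hper' : ∀ t, 0 ≤ t → Periodic fun x => u x (t + h) := fun t ht =>
      hu.periodic _ (add_nonneg ht hh)
    have hb := mul_nonneg hK₁ hh
    have h1 := hyp.comparison hcont hper' (hu.sub.shift hh)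
      (hcont' (K₁ * h)) (hper (K₁ * h)) (hu.super.add_const hyp hb)
      (fun x i => by
        rw [zero_add, hu.initial]
        linarith [(abs_le.1 (h0 x h hh i)).2]) (x := x) ht i
    have h2 := hyp.comparison (hcont' (-(K₁ * h))) (hper (-(K₁ * h)))
      (hu.sub.add_const hyp (neg_nonpos.2 hb)) hcont hper' (hu.super.shift hh)
      (fun x i => by
        rw [zero_add, hu.initial]
        linarith [(abs_le.1 (h0 x h hh i)).1]) (x := x) ht i
    rw [abs_le]
    constructor <;> linarith
  rcases le_total s t with h | h
  · have := key s (t - s) hs (sub_nonneg.2 h)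
    rw [add_sub_cancel] at this
    rwa [abs_of_nonneg (sub_nonneg.2 h)]
  · have := key t (s - t) ht (sub_nonneg.2 h)
    rw [add_sub_cancel] at this
    rwa [abs_sub_comm, abs_sub_comm t, abs_of_nonneg (sub_nonneg.2 h)]

/-- A subsolution of the evolution system which is Lipschitz continuous in time is Lipschitz
continuous in space, by coercivity. -/
lemma IsEvolutionSubsolution.sub_space_le {u : Space N → ℝ → Fin m → ℝ}
    (hsub : IsEvolutionSubsolution F f D u)
    (hcont : ContinuousOn (fun q : Space N × ℝ => u q.1 q.2) (univ ×ˢ Ici 0))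
    {K₁ M : ℝ} (hK₁ : 0 ≤ K₁) {i : Fin m}
    (htime : ∀ x t s, 0 ≤ t → 0 ≤ s → |u x t i - u x s i| ≤ K₁ * |t - s|)
    (hM : ∀ x t, 0 ≤ t → f i x - ∑ j, D x i j * u x t j + 2 * K₁ ≤ M) {R : NNReal}
    (hR : ∀ i x p, F i x p ≤ M → ‖p‖ ≤ R) {t₀ B : ℝ} (ht₀ : 0 < t₀) (hB0 : 0 ≤ B)
    (hB : ∀ x, ∀ t ∈ Icc 0 (t₀ + 1), |u x t i| ≤ B) (z x : Space N) :
    u z t₀ i - u x t₀ i ≤ R * ‖z - x‖ := by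
  -- The function `u i` minus the cone `R' * ‖y - x‖`, localized in time around `t₀`, is maximized;
  -- a maximum off the vertex would give a gradient of norm `R' > R`, so it lies at `y = x`.
  have key : ∀ R' : ℝ, R < R' → ∀ ε > 0, u z t₀ i - u x t₀ i ≤ R' * ‖z - x‖ + ε := by
    intro R' hR' ε hε
    have hR'0 : 0 < R' := lt_of_le_of_lt R.2 hR'
    set τ := min (t₀ / 2) 1
    have hτ : 0 < τ := by positivity
    have hτ2 : τ ≤ t₀ / 2 := min_le_left _ _
    have hτ1 : τ ≤ 1 := min_le_right _ _
    -- The maximum satisfies `κ * |s - t₀| ≤ K₁`. The first summand makes the time error `K₁ * |s -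
    -- t₀|` at most `ε`, the second keeps `s` interior.
    set κ := K₁ ^ 2 / ε + (K₁ + 1) / τ
    have hκ0 : 0 < κ := by positivity
    have hκε : K₁ ^ 2 ≤ κ * ε := by
      have h1 : K₁ ^ 2 / ε * ε = K₁ ^ 2 := div_mul_cancel₀ _ hε.ne'
      have h2 : 0 ≤ (K₁ + 1) / τ * ε := by positivity
      nlinarith
    have hκτ : K₁ + 1 ≤ κ * τ := by
      have h1 : (K₁ + 1) / τ * τ = K₁ + 1 := div_mul_cancel₀ _ hτ.ne'
      have h2 : 0 ≤ K₁ ^ 2 / ε * τ := by positivity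
      nlinarith
    -- The ball contains `z`, and since `R' * ρ > 2 * B` the maximum is not on its boundary.
    set ρ := ‖z - x‖ + (2 * B + 1) / R'
    have hρ0 : 0 < ρ := by positivity
    have hρz : ‖z - x‖ ≤ ρ := le_add_of_nonneg_right (by positivity)
    have hρB : 2 * B < R' * ρ := by
      have h1 : R' * ((2 * B + 1) / R') = 2 * B + 1 := mul_div_cancel₀ _ hR'0.ne'
      have h2 : 0 ≤ R' * ‖z - x‖ := by positivity
      simp only [ρ, mul_add]
      linarith
    set S : Set (Space N × ℝ) := Metric.closedBall x ρ ×ˢ Icc (t₀ - τ) (t₀ + τ)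
    have hS : IsCompact S := (isCompact_closedBall x ρ).prod isCompact_Icc
    have hSt : ∀ s ∈ Icc (t₀ - τ) (t₀ + τ), s ∈ Icc 0 (t₀ + 1) := fun s hs =>
      ⟨by linarith [hs.1], by linarith [hs.2]⟩
    have hScont : ContinuousOn (fun q : Space N × ℝ =>
        u q.1 q.2 i - R' * ‖q.1 - x‖ - κ * (q.2 - t₀) ^ 2) S := by
      have h1 : ContinuousOn (fun q : Space N × ℝ => u q.1 q.2 i) S :=
        (continuous_apply i).comp_continuousOn
          (hcont.mono fun q hq => ⟨mem_univ _, (hSt _ hq.2).1⟩)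
      have h2 : Continuous fun q : Space N × ℝ => R' * ‖q.1 - x‖ := by fun_prop
      have h3 : Continuous fun q : Space N × ℝ => κ * (q.2 - t₀) ^ 2 := by fun_prop
      exact (h1.sub h2.continuousOn).sub h3.continuousOn
    have ht₀S : t₀ ∈ Icc (t₀ - τ) (t₀ + τ) := ⟨by linarith, by linarith⟩
    obtain ⟨⟨y, s⟩, ⟨hy, hs⟩, hmax⟩ :=
      hS.exists_isMaxOn ⟨(x, t₀), by simp [hρ0.le], ht₀S⟩ hScont
    have hy : y ∈ Metric.closedBall x ρ := hy
    have hs : s ∈ Icc (t₀ - τ) (t₀ + τ) := hs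
    have hmax' : ∀ y' ∈ Metric.closedBall x ρ, ∀ s' ∈ Icc (t₀ - τ) (t₀ + τ),
        u y' s' i - R' * ‖y' - x‖ - κ * (s' - t₀) ^ 2 ≤
          u y s i - R' * ‖y - x‖ - κ * (s - t₀) ^ 2 := fun y' hy' s' hs' =>
      hmax (show (y', s') ∈ S from ⟨hy', hs'⟩)
    have hs0 := hSt s hs
    have hst := (abs_le.1 (htime y s t₀ hs0.1 ht₀.le)).2
    -- the maximum is attained close to `t₀`
    have hclose : κ * |s - t₀| ≤ K₁ := by
      have h1 := hmax' y hy t₀ ht₀S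
      rw [sub_self] at h1
      rcases (abs_nonneg (s - t₀)).eq_or_lt with h | h
      · rw [← h]; linarith
      · refine le_of_mul_le_mul_right ?_ h
        rw [mul_assoc, ← sq, sq_abs]
        linarith
    have hslt : |s - t₀| < τ := lt_of_mul_lt_mul_left (by linarith) hκ0.le
    have hslt' := abs_lt.1 hslt
    have hyx : y = x := by
      by_contra hne
      set a := ‖y - x‖
      have ha : 0 < a := norm_pos_iff.2 (sub_ne_zero.2 hne)
      have haρ : a < ρ := by
        have h1 := hmax' x (by simp [hρ0.le]) s hs
        simp only [sub_self, norm_zero, mul_zero, sub_zero] at h1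
        have h2 := (abs_le.1 (hB y s hs0)).2
        have h3 := (abs_le.1 (hB x s hs0)).1
        exact lt_of_mul_lt_mul_left (a := R') (by linarith) hR'0.le
      have hspos : 0 < s := by linarith
      -- The cone is replaced by the paraboloid that touches it from above at distance `a`. The time
      -- derivative is at least `-2 * K₁`, which accounts for the `2 * K₁` in the bound by `M`.
      have htest := hsub.test (g := fun _ => 0) contDiff_const (R' / (2 * a)) κ i (x := y)
        (y := x) (t := s) (s := t₀) hspos (by
          have hev : ∀ᶠ q : Space N × ℝ in 𝓝 (y, s),
              q.1 ∈ Metric.ball x ρ ∧ q.2 ∈ Ioo (t₀ - τ) (t₀ + τ) :=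
            ((continuous_fst.tendsto (y, s)).eventually
              (Metric.isOpen_ball.mem_nhds (by simpa [dist_eq_norm] using haρ))).and
              ((continuous_snd.tendsto (y, s)).eventually
                (Ioo_mem_nhds (by linarith) (by linarith)))
          filter_upwards [hev] with q hq
          have h1 := hmax' q.1 (Metric.ball_subset_closedBall hq.1) q.2 ⟨hq.2.1.le, hq.2.2.le⟩
          have h2 : R' / (2 * a) * ‖q.1 - x‖ ^ 2 + R' * a / 2 - R' * ‖q.1 - x‖
              = R' / (2 * a) * (‖q.1 - x‖ - a) ^ 2 := by
            field_simp
            ring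
          have h3 : 0 ≤ R' / (2 * a) * (‖q.1 - x‖ - a) ^ 2 := by positivity
          have h4 : R' / (2 * a) * a ^ 2 = R' * a / 2 := by
            field_simp
          change _ ≤ u y s i - (R' / (2 * a) * a ^ 2 + κ * (s - t₀) ^ 2 + 0)
          change _ ≤ u y s i - R' * a - κ * (s - t₀) ^ 2 at h1
          linarith)
      have hF : F i y ((2 * (R' / (2 * a))) • (y - x)) ≤ M := by
        rw [deriv_const] at htest
        have h1 := hM y s hs0.1
        have h2 : -K₁ ≤ κ * (s - t₀) := by
          have := mul_le_mul_of_nonneg_left (neg_abs_le (s - t₀)) hκ0.le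
          linarith
        linarith
      have hnorm := hR i y _ hF
      rw [norm_smul, Real.norm_of_nonneg (by positivity)] at hnorm
      have h2 : 2 * (R' / (2 * a)) * ‖y - x‖ = R' := by
        change 2 * (R' / (2 * a)) * a = R'
        field_simp
      linarith
    subst hyx
    have h1 := hmax' z (by simpa [dist_eq_norm] using hρz) t₀ ht₀S
    simp only [sub_self, norm_zero, mul_zero, sub_zero] at h1
    have h2 : K₁ * |s - t₀| ≤ ε := by
      refine le_of_mul_le_mul_left ?_ hκ0
      nlinarith
    have h3 : 0 ≤ κ * (s - t₀) ^ 2 := by positivity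
    simp only [ne_eq, OfNat.ofNat_ne_zero, not_false_eq_true, zero_pow, mul_zero, sub_zero] at h1
    linarith
  refine le_of_forall_pos_le_add fun ε hε => ?_
  set η : ℝ := ε / (2 * (‖z - x‖ + 1))
  have hη : 0 < η := by positivity
  have hηz : η * ‖z - x‖ ≤ ε / 2 := by
    rw [div_mul_eq_mul_div, div_le_iff₀ (by positivity)]
    nlinarith [norm_nonneg (z - x)]
  have := key (R + η) (by linarith) (ε / 2) (by positivity)
  linarith

/-- Lipschitz continuity in space and time. -/
lemma Assumptions.exists_lipschitz_evolution (hyp : Assumptions F f D)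
    (hc : IsErgodicConstant F f D c) (hper : Periodic u₀) {K : NNReal}
    (hK : LipschitzWith K u₀) :
    ∃ L : ℝ, ∀ u, IsEvolutionSolution F f D u₀ u →
      ∀ x y t s, 0 ≤ t → 0 ≤ s → ∀ i,
        |u x t i - u y s i| ≤ L * (‖x - y‖ + |t - s|) := by
  obtain ⟨C, hC0, hC⟩ := hyp.exists_abs_add_le hc hper hK.continuous
  obtain ⟨K₁, hK₁, hini⟩ := hyp.exists_abs_sub_initial_le hper hK
  obtain ⟨A₁, hA₁0, hA₁⟩ := hyp.exists_f_le
  obtain ⟨A₂, hA₂0, hA₂⟩ := hyp.exists_abs_coupling_le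
  obtain ⟨R, hR⟩ := hyp.exists_norm_le (A₁ + A₂ * C + 2 * K₁)
  refine ⟨K₁ + R + K, fun u hu x y t s ht hs i => ?_⟩
  have htime := fun x t s ht hs i => hu.abs_sub_time_le hyp hK₁ (hini u hu) x (t := t) (s := s) ht hs i
  have hM : ∀ i x t, 0 ≤ t → f i x - ∑ j, D x i j * u x t j + 2 * K₁ ≤ A₁ + A₂ * C + 2 * K₁ := by
    intro i x t ht
    have h1 := hA₂ x i (fun j => u x t j + c j * t) C fun j => hC u hu x t ht j
    -- Because `D c = 0`, the coupling of `u` is that of the bounded function `u + c t`, hence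
    -- bounded uniformly in time.
    have h2 : ∑ j, D x i j * (u x t j + c j * t) = ∑ j, D x i j * u x t j := by
      have : ∑ j, D x i j * (u x t j + c j * t) =
          ∑ j, D x i j * u x t j + (∑ j, D x i j * c j) * t := by
        rw [Finset.sum_mul, ← Finset.sum_add_distrib]
        exact Finset.sum_congr rfl fun j _ => by ring
      rw [this, hc.1, zero_mul, add_zero]
    rw [h2] at h1
    linarith [hA₁ i x, (abs_le.1 h1).1]
  have hle : ∀ z x, u z t i - u x t i ≤ (R + K) * ‖z - x‖ := by
    intro z x
    -- The equation gives information only at positive times; at `t = 0` the Lipschitz constant `K`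
    -- of the datum is used.
    rcases ht.eq_or_lt with h | h
    · rw [← h, hu.initial, hu.initial]
      have h1 := (dist_le_pi_dist (u₀ z) (u₀ x) i).trans (hK.dist_le_mul z x)
      rw [Real.dist_eq, dist_eq_norm] at h1
      have h2 : 0 ≤ (R : ℝ) * ‖z - x‖ := by positivity
      linarith [le_abs_self (u₀ z i - u₀ x i)]
    · have hB : ∀ x, ∀ r ∈ Icc 0 (t + 1), |u x r i| ≤ C + |c i| * (t + 1) := by
        intro x r hr
        have h1 := hC u hu x r hr.1 i
        have h2 : |c i * r| ≤ |c i| * (t + 1) := by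
          rw [abs_mul, abs_of_nonneg hr.1]
          exact mul_le_mul_of_nonneg_left hr.2 (abs_nonneg _)
        have h3 := abs_sub (u x r i + c i * r) (c i * r)
        rw [add_sub_cancel_right] at h3
        linarith
      have h1 := hu.sub.sub_space_le hu.continuousOn hK₁
        (fun x t s ht hs => htime x t s ht hs i) (hM i) hR h (by positivity) hB z x
      have h2 : 0 ≤ (K : ℝ) * ‖z - x‖ := by positivity
      linarith
  have hspace : |u x t i - u y t i| ≤ (R + K) * ‖x - y‖ := by
    have h1 := hle y x
    rw [norm_sub_rev] at h1
    exact abs_sub_le_iff.2 ⟨hle x y, h1⟩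
  have h1 := abs_sub_le (u x t i) (u y t i) (u y s i)
  have h2 := htime y t s ht hs i
  have h3 : 0 ≤ K₁ * ‖x - y‖ := by positivity
  have h4 : 0 ≤ (R + K : ℝ) * |t - s| := by positivity
  linarith

/-- A function at bounded distance from `-a t` has slope `-a` at infinity. -/
lemma tendstoUniformly_div_of_abs_add_le {α : Type*} {w : α → ℝ → ℝ} {a C : ℝ}
    (h : ∀ x t, 0 ≤ t → |w x t + a * t| ≤ C) :
    TendstoUniformly (fun (t : ℝ) (x : α) => w x t / t) (fun _ => -a) atTop := by
  rw [Metric.tendstoUniformly_iff]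
  intro ε hε
  filter_upwards [eventually_gt_atTop (0 : ℝ), eventually_gt_atTop (C / ε)] with t ht htC x
  have h1 : -a - w x t / t = -((w x t + a * t) / t) := by
    field_simp
    ring
  rw [Real.dist_eq, h1, abs_neg, abs_div, abs_of_pos ht, div_lt_iff₀ ht]
  rw [div_lt_iff₀ hε] at htC
  linarith [h x t ht.le]

end EvolutionEstimates

end HJSystem

theorem proposition5p2 {N m : ℕ}
    (F : Fin m → HJSystem.Space N → HJSystem.Space N → ℝ) (f : Fin m → HJSystem.Space N → ℝ)
    (D : HJSystem.Space N → Matrix (Fin m) (Fin m) ℝ)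
    (hyp : HJSystem.Assumptions F f D)
    (hcase : HJSystem.CommonZeroCase f D ∨ HJSystem.ConstantCouplingCase D) :
    ∃ c : Fin m → ℝ,
      -- `c` is the ergodic constant, and it vanishes if the `f_i` have a common zero
      (HJSystem.IsErgodicConstant F f D c ∧
        (∀ c' : Fin m → ℝ, HJSystem.IsErgodicConstant F f D c' → c' = c) ∧
        (HJSystem.CommonZeroCase f D → c = 0)) ∧
      ∀ u₀ : HJSystem.Space N → Fin m → ℝ, HJSystem.Periodic u₀ →
        (∃ K, LipschitzWith K u₀) →
        ∃ C L : ℝ, ∀ u : HJSystem.Space N → ℝ → Fin m → ℝ,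
          HJSystem.IsEvolutionSolution F f D u₀ u →
          (∀ x t, 0 ≤ t → ∀ i, |u x t i + c i * t| ≤ C) ∧
          (∀ x y t s, 0 ≤ t → 0 ≤ s → ∀ i,
            |u x t i - u y s i| ≤ L * (‖x - y‖ + |t - s|)) ∧
          ∀ i, TendstoUniformly (fun (t : ℝ) (x : HJSystem.Space N) => u x t i / t)
            (fun _ => -c i) Filter.atTop := by
  obtain ⟨c, hc, hc0⟩ := hyp.exists_isErgodicConstant hcase
  refine ⟨c, ⟨hc, fun c' hc' => funext fun i => le_antisymm (hyp.ergodicConstant_le hc hc' i)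
    (hyp.ergodicConstant_le hc' hc i), hc0⟩, fun u₀ hper hlip => ?_⟩
  obtain ⟨K, hK⟩ := hlip
  obtain ⟨C, -, hC⟩ := hyp.exists_abs_add_le hc hper hK.continuous
  obtain ⟨L, hL⟩ := hyp.exists_lipschitz_evolution hc hper hK
  refine ⟨C, L, fun u hu => ⟨hC u hu, hL u hu, fun i => ?_⟩⟩
  exact HJSystem.tendstoUniformly_div_of_abs_add_le fun x t ht => hC u hu x t ht i
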